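/- Let $(b_k)_{k\ge 1}$ and $(N_k)_{k\ge 1}$ be sequences of positive integers with $N_k\ge b_k\ge 2$ and $b_k\mid N_k$ for every $k\ge1$, and $\sum_{k=1}^\infty \frac1{b_k}<\infty$. For $k\ge 1$ put $$B_k=\{0,1,\dots,b_k-2,\; b_k-1+(N_1N_2\cdots N_k)\cdot k!\},\qquad A_k=(N_1N_2\cdots N_k)^{-1}B_k\subset\mathbb R,$$ and let $\delta_{A_k}=\frac{1}{\#A_k}\sum_{a\in A_k}\delta_a$ be the uniform probability measure on $A_k$. Then the convolutions $\delta_{A_1}*\delta_{A_2}*\cdots*\delta_{A_n}$ converge weakly, as $n\to\infty$, to a Borel probability measure $\mu=\delta_{A_1}*\delta_{A_2}*\cdots$ on $\mathbb R$, and its support $\mathrm{spt}(\mu)$ (the smallest closed set of full $\mu$-measure) satisfies $$\dim_H \mathrm{spt}(\mu)=\liminf_{k\to\infty}\frac{\log (b_1b_2\cdots b_k)}{\log (N_1N_2\cdots N_{k+1})-\log b_{k+1}}$$ and $$\dim_P \mathrm{spt}(\mu)=\limsup_{k\to\infty}\frac{\log (b_1b_2\cdots b_k)}{\log (N_1N_2\cdots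 N_k)},$$ where $\dim_H$ and $\dim_P$ denote the Hausdorff and the packing dimension. -/

import Mathlib

open MeasureTheory Filter Topology
open scoped ENNReal NNReal

/-! ### Packing measure and packing dimension -/

section Packing

variable {X : Type*} [PseudoMetricSpace X]

/-- A finite `δ`-packing of `E`: finitely many pairwise disjoint closed balls with centres in `E`
and radii in `(0, δ]`; the pair `(x, r)` stands for the closed ball of radius `r` around `x`. -/
def IsPacking (δ : ℝ) (E : Set X) (P : Finset (X × ℝ)) : Prop :=
  (∀ p ∈ P, p.1 ∈ E ∧ 0 < p.2 ∧ p.2 ≤ δ) ∧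
    (P : Set (X × ℝ)).PairwiseDisjoint (fun p => Metric.closedBall p.1 p.2)

/-- The `s`-dimensional packing pre-measure
`P₀ˢ(E) = lim_{δ → 0} sup {∑ (2 rᵢ)ˢ : (B(xᵢ, rᵢ)) a δ-packing of E}`; the limit is an infimum since
the supremum is monotone in `δ`, and countable packings give the same supremum as finite ones. -/
noncomputable def packingPreMeasure (s : ℝ≥0) (E : Set X) : ℝ≥0∞ :=
  ⨅ (δ : ℝ) (_ : 0 < δ), ⨆ (P : Finset (X × ℝ)) (_ : IsPacking δ E P),
    ∑ p ∈ P, ENNReal.ofReal (2 * p.2) ^ (s : ℝ)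

/-- The `s`-dimensional packing measure
`Pˢ(E) = inf {∑ P₀ˢ(Fᵢ) : E ⊆ ⋃ Fᵢ}`, over countable covers by arbitrary sets. -/
noncomputable def packingMeasure (s : ℝ≥0) (E : Set X) : ℝ≥0∞ :=
  ⨅ (F : ℕ → Set X) (_ : E ⊆ ⋃ i, F i), ∑' i, packingPreMeasure s (F i)

/-- The packing dimension `sup {s ≥ 0 : Pˢ(E) = ∞}`, in the same form as Mathlib's `dimH`. -/
noncomputable def dimP (E : Set X) : ℝ≥0∞ :=
  ⨆ (s : ℝ≥0) (_ : packingMeasure s E = ∞), (s : ℝ≥0∞)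

end Packing

/-! ### Infinite convolutions of uniform discrete measures -/

/-- The uniform probability measure `δ_A = (1 / #A) ∑_{a ∈ A} δ_a` on a nonempty finite set `A`. -/
noncomputable def uniformDiscrete (A : Finset ℝ) (hA : A.Nonempty) : ProbabilityMeasure ℝ :=
  ⟨ProbabilityTheory.uniformOn (A : Set ℝ),
    ProbabilityTheory.isProbabilityMeasure_uniformOn A.finite_toSet hA⟩

/-- The finite convolution `δ_{A 1} ∗ ⋯ ∗ δ_{A n}` (the unit mass at `0` for `n = 0`). The sequence
is indexed from `1`; `A 0` is not used. -/
noncomputable def finConvolution (A : ℕ → Finset ℝ) (hA : ∀ k, (A k).Nonempty) :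
    ℕ → ProbabilityMeasure ℝ
  | 0 => ⟨Measure.dirac 0, inferInstance⟩
  | n + 1 =>
    ⟨(finConvolution A hA n : Measure ℝ) ∗ (uniformDiscrete (A (n + 1)) (hA (n + 1)) : Measure ℝ),
      inferInstance⟩

/-- `μ` is the infinite convolution `δ_{A 1} ∗ δ_{A 2} ∗ ⋯`, i.e. the weak limit of the finite
convolutions. -/
def IsInfiniteConvolution (A : ℕ → Finset ℝ) (hA : ∀ k, (A k).Nonempty)
    (μ : ProbabilityMeasure ℝ) : Prop :=
  Tendsto (finConvolution A hA) atTop (𝓝 μ)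

/-! ### The digit sets -/

/-- `B_k = {0, 1, …, b_k - 2, b_k - 1 + (N_1 ⋯ N_k) k!}`. -/
def digitSet (b N : ℕ → ℕ) (k : ℕ) : Finset ℕ :=
  insert (b k - 1 + (∏ i ∈ Finset.Icc 1 k, N i) * k.factorial) (Finset.range (b k - 1))

/-- `A_k = (N_1 ⋯ N_k)⁻¹ B_k`. -/
noncomputable def scaledDigitSet (b N : ℕ → ℕ) (k : ℕ) : Finset ℝ :=
  (digitSet b N k).image (fun d : ℕ => (∏ i ∈ Finset.Icc 1 k, (N i : ℝ))⁻¹ * (d : ℝ))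

theorem scaledDigitSet_nonempty (b N : ℕ → ℕ) (k : ℕ) : (scaledDigitSet b N k).Nonempty :=
  (Finset.insert_nonempty _ _).image _

/-! The limit is the law of a random series with independent uniform digits, the last digit of level
`k` carrying the shift `k!`. Write `B_k = b_1⋯b_k`, `P_k = N_1⋯N_k`, `Q_k = P_{k+1} / b_{k+1}`.
Since `∑ 1/b_k < ∞`, Borel–Cantelli leaves almost surely finitely many shifts, so the series
converges almost surely and hence in law. As `k!` is unbounded, a bounded part of the support only
involves shifts at finitely many levels; the support therefore lies in a countable union of compact
sets `digitSum c M '' tameDigits c n`.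

Upper bounds: beyond level `n` such a set is covered by `B_k` intervals of length `1/Q_k`, because
unshifted digits are consecutive; this bounds `dimH`. For `dimP`, balls centred in the set have mass
at least a constant times `r^t` (`rpow_le_digitSumLaw_closedBall`). Lower bounds: sequences without
any shift have positive probability. Their image measure `tameMeasure` charges the support, and
counting grid points bounds its mass on balls (`tameMeasure_closedBall_le`). The mass distribution
principle and its packing analogue conclude. -/

/-! ### Dimension bounds from the mass of balls -/

/-- Mass distribution principle: a set lies in a ball whose radius is its diameter, so `ν` is at
most `C` times Hausdorff measure. -/
theorem le_dimH_of_measure_closedBall_le {X : Type*} [MetricSpace X] [MeasurableSpace X]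
    [BorelSpace X] (ν : Measure X) {E : Set X} (hE : ν E ≠ 0) {C δ : ℝ} {s : ℝ≥0} (hC : 0 < C)
    (hδ : 0 < δ) (hs : 0 < s)
    (h : ∀ x r, 0 < r → r ≤ δ → ν (Metric.closedBall x r) ≤ ENNReal.ofReal (C * r ^ (s : ℝ))) :
    (s : ℝ≥0∞) ≤ dimH E := by
  have hC' : ENNReal.ofReal C ≠ 0 := by simpa using hC
  have key : (ENNReal.ofReal C)⁻¹ • ν ≤ Measure.hausdorffMeasure (s : ℝ) := by
    refine Measure.le_hausdorffMeasure _ _ (ENNReal.ofReal δ) (by simpa using hδ) fun A hA => ?_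
    rw [Measure.smul_apply, smul_eq_mul, ENNReal.inv_mul_le_iff hC' ENNReal.ofReal_ne_top]
    rcases A.eq_empty_or_nonempty with rfl | ⟨x, hx⟩
    · simp
    have hfin : Metric.ediam A ≠ ∞ := (hA.trans_lt ENNReal.ofReal_lt_top).ne
    have hbdd : Bornology.IsBounded A := Metric.isBounded_iff_ediam_ne_top.2 hfin
    have hed : Metric.ediam A = ENNReal.ofReal (Metric.diam A) :=
      (ENNReal.ofReal_toReal hfin).symm
    have hdδ : Metric.diam A ≤ δ := by
      rw [hed] at hA
      exact (ENNReal.ofReal_le_ofReal_iff hδ.le).1 hA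
    have hsub : ∀ r, Metric.diam A ≤ r → A ⊆ Metric.closedBall x r := fun r hr y hy =>
      (Metric.dist_le_diam_of_mem hbdd hy hx).trans hr
    -- Radius zero is not covered by `h`; for zero diameter let `r → 0`, where `0 < s` kills the
    -- bound.
    rcases (Metric.diam_nonneg (s := A)).eq_or_lt with h0 | h0
    · have hν : ν A ≤ 0 := by
        have hlim : Tendsto (fun r : ℝ => ENNReal.ofReal (C * r ^ (s : ℝ))) (𝓝[>] 0) (𝓝 0) := by
          have : ContinuousAt (fun r : ℝ => ENNReal.ofReal (C * r ^ (s : ℝ))) 0 := by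
            refine ENNReal.continuous_ofReal.continuousAt.comp ?_
            exact continuousAt_const.mul (Real.continuousAt_rpow_const _ _ (Or.inr (by simp)))
          have h1 := this.tendsto.mono_left (nhdsWithin_le_nhds (s := Set.Ioi 0))
          simpa [Real.zero_rpow (NNReal.coe_ne_zero.2 hs.ne')] using h1
        refine ge_of_tendsto hlim ?_
        filter_upwards [Ioc_mem_nhdsGT hδ] with r hr
        exact (measure_mono (hsub r (h0 ▸ hr.1.le))).trans (h x r hr.1 hr.2)
      exact hν.trans zero_le
    · rw [hed, ENNReal.ofReal_rpow_of_pos h0, ← ENNReal.ofReal_mul hC.le]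
      exact (measure_mono (hsub _ le_rfl)).trans (h x _ h0 hdδ)
  refine le_dimH_of_hausdorffMeasure_ne_zero fun h0 => hE ?_
  have := key E
  rw [h0, Measure.smul_apply, smul_eq_mul, nonpos_iff_eq_zero, mul_eq_zero] at this
  exact this.resolve_left (ENNReal.inv_ne_zero.2 ENNReal.ofReal_ne_top)

/-- Some piece of any countable cover has positive mass. Disjoint balls of one good radius `r` whose
enlargements cover that piece bound its mass by `C (2r)^(t-s)` times a packing sum, so the packing
sums are unbounded. Arbitrarily small good radii suffice. -/
theorem packingMeasure_eq_top_of_measure_closedBall_le {X : Type*} [MetricSpace X]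
    [SecondCountableTopology X] [MeasurableSpace X] (ν : Measure X) {E : Set X} (hE : ν E ≠ 0)
    {C t : ℝ} {s : ℝ≥0} (hst : s < t) (hC : 0 < C)
    (h : ∀ δ > 0, ∃ r, 0 < r ∧ r ≤ δ ∧
      ∀ x, ν (Metric.closedBall x (4 * r)) ≤ ENNReal.ofReal (C * (2 * r) ^ t)) :
    packingMeasure s E = ∞ := by
  rw [packingMeasure, iInf₂_eq_top]
  intro F hF
  obtain ⟨i, hi⟩ : ∃ i, ν (F i) ≠ 0 := by
    by_contra! hcon
    exact hE (measure_mono_null hF (measure_iUnion_null hcon))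
  refine ENNReal.tsum_eq_top_of_eq_top ⟨i, ?_⟩
  rw [packingPreMeasure, iInf₂_eq_top]
  intro δ hδ
  set S := ⨆ (P : Finset (X × ℝ)) (_ : IsPacking δ (F i) P),
    ∑ p ∈ P, ENNReal.ofReal (2 * p.2) ^ (s : ℝ) with hS
  have key : ∀ η > 0, ∃ r, 0 < r ∧ r ≤ η ∧
      ν (F i) ≤ ENNReal.ofReal (C * (2 * r) ^ (t - s)) * S := by
    intro η hη
    obtain ⟨r, hr0, hr, hν⟩ := h (min η δ) (lt_min hη hδ)
    refine ⟨r, hr0, hr.trans (min_le_left _ _), ?_⟩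
    -- The covering lemma needs an enlargement factor above 3; this is the origin of `4 * r` in `h`.
    obtain ⟨u, hu, hdisj, hcov⟩ := Vitali.exists_disjoint_subfamily_covering_enlargement_closedBall
      (F i) id (fun _ => r) r (fun _ _ => le_rfl) 4 (by norm_num)
    have hcount : u.Countable := hdisj.countable_of_nonempty_interior fun x _ =>
      ⟨x, Metric.ball_subset_interior_closedBall (Metric.mem_ball_self hr0)⟩
    have hsum : ∑' _ : u, ENNReal.ofReal (2 * r) ^ (s : ℝ) ≤ S := by
      rw [ENNReal.tsum_eq_iSup_sum]
      refine iSup_le fun Q => ?_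
      classical
      let P : Finset (X × ℝ) := Q.map ⟨fun x : u => ((x : X), r), fun x y hxy => by
        simpa [Subtype.ext_iff] using hxy⟩
      have hP : IsPacking δ (F i) P := by
        refine ⟨?_, ?_⟩
        · intro p hp
          obtain ⟨x, -, rfl⟩ := Finset.mem_map.1 hp
          exact ⟨hu x.2, hr0, hr.trans (min_le_right _ _)⟩
        · intro p hp q hq hpq
          obtain ⟨x, -, rfl⟩ := Finset.mem_map.1 (Finset.mem_coe.1 hp)
          obtain ⟨y, -, rfl⟩ := Finset.mem_map.1 (Finset.mem_coe.1 hq)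
          exact hdisj x.2 y.2 fun hxy => hpq (by
            have : x = y := Subtype.ext hxy
            rw [this])
      have : ∑ p ∈ P, ENNReal.ofReal (2 * p.2) ^ (s : ℝ) =
          ∑ _ ∈ Q, ENNReal.ofReal (2 * r) ^ (s : ℝ) :=
        Finset.sum_map _ _ _
      rw [← this, hS]
      exact le_iSup₂_of_le P hP le_rfl
    have hsub : F i ⊆ ⋃ x ∈ u, Metric.closedBall x (4 * r) := by
      intro x hx
      obtain ⟨y, hy, hxy⟩ := hcov x hx
      exact Set.mem_biUnion hy (hxy (Metric.mem_closedBall_self hr0.le))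
    have h2r : 0 < 2 * r := by positivity
    calc ν (F i) ≤ ν (⋃ x ∈ u, Metric.closedBall x (4 * r)) := measure_mono hsub
      _ ≤ ∑' x : u, ν (Metric.closedBall (x : X) (4 * r)) := measure_biUnion_le _ hcount _
      _ ≤ ∑' _ : u, ENNReal.ofReal (C * (2 * r) ^ (t - s)) * ENNReal.ofReal (2 * r) ^ (s : ℝ) := by
        refine ENNReal.tsum_le_tsum fun x => (hν x).trans_eq ?_
        rw [ENNReal.ofReal_rpow_of_pos h2r, ← ENNReal.ofReal_mul (by positivity), mul_assoc,
          ← Real.rpow_add h2r, sub_add_cancel]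
      _ ≤ _ := by
        rw [ENNReal.tsum_mul_left]
        gcongr
  by_contra hS'
  have hlim : Tendsto (fun r : ℝ => ENNReal.ofReal (C * (2 * r) ^ (t - s)) * S) (𝓝 0) (𝓝 0) := by
    have h1 : ContinuousAt (fun r : ℝ => ENNReal.ofReal (C * (2 * r) ^ (t - s))) 0 := by
      refine ENNReal.continuous_ofReal.continuousAt.comp (continuousAt_const.mul ?_)
      exact (continuousAt_const.mul continuousAt_id).rpow_const (Or.inr (by simpa using hst.le))
    have h2 := ENNReal.Tendsto.mul_const (b := S) h1.tendsto (Or.inr hS')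
    simpa [Real.zero_rpow (sub_pos.2 hst).ne'] using h2
  have hev := hlim.eventually (gt_mem_nhds (pos_iff_ne_zero.2 hi))
  obtain ⟨η, hη, hball⟩ := Metric.eventually_nhds_iff.1 hev
  obtain ⟨r, hr0, hr, hle⟩ := key (η / 2) (by positivity)
  refine absurd hle (not_le.2 (hball ?_))
  rw [Real.dist_eq, sub_zero, abs_of_pos hr0]
  linarith

/-- The balls of a packing are disjoint, so the sum of `c r^t` is at most the finite total mass; the
surplus power `s - t` then sends the packing sums to zero. -/
theorem packingPreMeasure_eq_zero_of_le_measure_closedBall {X : Type*} [PseudoMetricSpace X]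
    [MeasurableSpace X] [OpensMeasurableSpace X] (ν : Measure X) [IsFiniteMeasure ν] {E : Set X}
    {c δ t : ℝ} {s : ℝ≥0} (hc : 0 < c) (hδ : 0 < δ) (hst : t < s)
    (h : ∀ x ∈ E, ∀ r, 0 < r → r ≤ δ →
      ENNReal.ofReal (c * r ^ t) ≤ ν (Metric.closedBall x r)) :
    packingPreMeasure s E = 0 := by
  have key : ∀ η, 0 < η → η ≤ δ →
      packingPreMeasure s E ≤ ENNReal.ofReal (2 ^ (s : ℝ) / c * η ^ (s - t)) * ν Set.univ := by
    intro η hη hηδ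
    refine iInf₂_le_of_le η hη (iSup₂_le fun P hP => ?_)
    calc ∑ p ∈ P, ENNReal.ofReal (2 * p.2) ^ (s : ℝ)
        ≤ ∑ p ∈ P, ENNReal.ofReal (2 ^ (s : ℝ) / c * η ^ (s - t)) *
            ν (Metric.closedBall p.1 p.2) := by
          refine Finset.sum_le_sum fun p hp => ?_
          obtain ⟨hpE, hp0, hpη⟩ := hP.1 p hp
          refine le_trans ?_ (mul_le_mul_right (h p.1 hpE p.2 hp0 (hpη.trans hηδ)) _)
          rw [ENNReal.ofReal_rpow_of_pos (by positivity), ← ENNReal.ofReal_mul (by positivity)]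
          refine ENNReal.ofReal_le_ofReal ?_
          rw [Real.mul_rpow (by norm_num) hp0.le]
          calc (2 : ℝ) ^ (s : ℝ) * p.2 ^ (s : ℝ) = 2 ^ (s : ℝ) * (p.2 ^ (s - t) * p.2 ^ t) := by
                rw [← Real.rpow_add hp0, sub_add_cancel]
            _ ≤ 2 ^ (s : ℝ) * (η ^ (s - t) * p.2 ^ t) := by
                have := Real.rpow_le_rpow hp0.le hpη (sub_nonneg.2 hst.le)
                gcongr
            _ = _ := by field_simp
      _ = ENNReal.ofReal (2 ^ (s : ℝ) / c * η ^ (s - t)) *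
            ν (⋃ p ∈ P, Metric.closedBall p.1 p.2) := by
          rw [measure_biUnion_finset hP.2 fun p _ => Metric.isClosed_closedBall.measurableSet,
            Finset.mul_sum]
      _ ≤ _ := by gcongr; exact Set.subset_univ _
  have hlim : Tendsto (fun η : ℝ => ENNReal.ofReal (2 ^ (s : ℝ) / c * η ^ (s - t)) * ν Set.univ)
      (𝓝[>] 0) (𝓝 0) := by
    have h1 : ContinuousAt (fun η : ℝ => ENNReal.ofReal (2 ^ (s : ℝ) / c * η ^ (s - t))) 0 := by
      refine ENNReal.continuous_ofReal.continuousAt.comp (continuousAt_const.mul ?_)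
      exact Real.continuousAt_rpow_const _ _ (Or.inr (sub_nonneg.2 hst.le))
    have h2 := ENNReal.Tendsto.mul_const (b := ν Set.univ) h1.tendsto
      (Or.inr (measure_ne_top _ _))
    rw [Real.zero_rpow (sub_pos.2 hst).ne', mul_zero, ENNReal.ofReal_zero, zero_mul] at h2
    exact h2.mono_left nhdsWithin_le_nhds
  refine le_antisymm (ge_of_tendsto hlim ?_) zero_le
  filter_upwards [Ioc_mem_nhdsGT hδ] with η hη using key η hη.1 hη.2

theorem packingMeasure_mono {X : Type*} [PseudoMetricSpace X] (s : ℝ≥0) {E F : Set X}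
    (h : E ⊆ F) : packingMeasure s E ≤ packingMeasure s F :=
  le_iInf₂ fun G hG => iInf₂_le G (h.trans hG)

theorem packingMeasure_iUnion_eq_zero {X : Type*} [PseudoMetricSpace X] {s : ℝ≥0}
    {F : ℕ → Set X} (h : ∀ i, packingPreMeasure s (F i) = 0) :
    packingMeasure s (⋃ i, F i) = 0 :=
  le_antisymm (iInf₂_le_of_le F subset_rfl (by simp [h])) zero_le

/-! ### Digit expansions with variable base -/

/-- The product of the first `k` terms of a sequence. -/
def cumProd (f : ℕ → ℕ) (k : ℕ) : ℕ := ∏ i ∈ Finset.range k, f i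

theorem cumProd_zero (f : ℕ → ℕ) : cumProd f 0 = 1 := by simp [cumProd]

theorem cumProd_succ (f : ℕ → ℕ) (k : ℕ) : cumProd f (k + 1) = cumProd f k * f k := by
  simp [cumProd, Finset.prod_range_succ]

theorem two_pow_le_cumProd {f : ℕ → ℕ} (hf : ∀ i, 2 ≤ f i) (k : ℕ) : 2 ^ k ≤ cumProd f k := by
  induction k with
  | zero => simp [cumProd_zero]
  | succ k ih => rw [cumProd_succ, pow_succ]; exact Nat.mul_le_mul ih (hf k)

theorem cumProd_pos {f : ℕ → ℕ} (hf : ∀ i, 2 ≤ f i) (k : ℕ) : 0 < cumProd f k :=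
  (pow_pos two_pos k).trans_le (two_pow_le_cumProd hf k)

theorem cumProd_le_cumProd {f g : ℕ → ℕ} (h : ∀ i, f i ≤ g i) (k : ℕ) :
    cumProd f k ≤ cumProd g k :=
  Finset.prod_le_prod' fun i _ => h i

theorem tendsto_cumProd_atTop {f : ℕ → ℕ} (hf : ∀ i, 2 ≤ f i) :
    Tendsto (fun k => (cumProd f k : ℝ)) atTop atTop := by
  refine tendsto_atTop_mono (fun k => ?_) (tendsto_pow_atTop_atTop_of_one_lt (one_lt_two (α := ℝ)))
  exact_mod_cast two_pow_le_cumProd hf k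

/-- The contribution of the digit index `d` at position `i`; the index `c i - 1` carries the extra
shift `(i + 1)!`. -/
noncomputable def digitTerm (c M : ℕ → ℕ) (i d : ℕ) : ℝ :=
  d / cumProd M (i + 1) + if d + 1 = c i then ((i + 1).factorial : ℝ) else 0

/-- The sum of the first `k` digit contributions. -/
noncomputable def prefixSum (c M : ℕ → ℕ) (k : ℕ) (ω : ℕ → ℕ) : ℝ :=
  ∑ i ∈ Finset.range k, digitTerm c M i (ω i)

/-- The real number with digit sequence `ω`. -/
noncomputable def digitSum (c M : ℕ → ℕ) (ω : ℕ → ℕ) : ℝ := ∑' i, digitTerm c M i (ω i)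

theorem digitTerm_nonneg (c M : ℕ → ℕ) (i d : ℕ) : 0 ≤ digitTerm c M i d := by
  unfold digitTerm; positivity

theorem digitTerm_of_small {c : ℕ → ℕ} (M : ℕ → ℕ) {i d : ℕ} (h : d + 2 ≤ c i) :
    digitTerm c M i d = d / cumProd M (i + 1) := by
  simp [digitTerm, show d + 1 ≠ c i by omega]

theorem factorial_le_digitTerm {c : ℕ → ℕ} (M : ℕ → ℕ) {i d : ℕ} (h : d + 1 = c i) :
    ((i + 1).factorial : ℝ) ≤ digitTerm c M i d := by
  simp only [digitTerm, h, if_true]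
  exact le_add_of_nonneg_left (by positivity)

theorem prefixSum_succ (c M : ℕ → ℕ) (k : ℕ) (ω : ℕ → ℕ) :
    prefixSum c M (k + 1) ω = prefixSum c M k ω + digitTerm c M k (ω k) := by
  simp [prefixSum, Finset.sum_range_succ]

theorem prefixSum_mono (c M : ℕ → ℕ) (ω : ℕ → ℕ) : Monotone fun k => prefixSum c M k ω :=
  monotone_nat_of_le_succ fun k => by
    rw [prefixSum_succ]; exact le_add_of_nonneg_right (digitTerm_nonneg c M k _)

theorem prefixSum_congr (c M : ℕ → ℕ) {k : ℕ} {ω ω' : ℕ → ℕ} (h : ∀ i < k, ω i = ω' i) :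
    prefixSum c M k ω = prefixSum c M k ω' :=
  Finset.sum_congr rfl fun i hi => by rw [h i (Finset.mem_range.1 hi)]

/-- The right side telescopes, which bounds tails without shifts by `1 / cumProd M k`. -/
theorem digit_div_le {c M : ℕ → ℕ} (hc : ∀ i, 2 ≤ c i) (hcM : ∀ i, c i ≤ M i) {i d : ℕ} (h : d < c i) :
    (d : ℝ) / cumProd M (i + 1) ≤ 1 / cumProd M i - 1 / cumProd M (i + 1) := by
  have hM : ∀ i, 2 ≤ M i := fun i => (hc i).trans (hcM i)
  have h0 : (0 : ℝ) < cumProd M i := by exact_mod_cast cumProd_pos hM i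
  have h1 : (0 : ℝ) < M i := by exact_mod_cast two_pos.trans_le (hM i)
  have h2 : (d : ℝ) + 1 ≤ M i := by exact_mod_cast Nat.succ_le_of_lt (h.trans_le (hcM i))
  rw [cumProd_succ]
  push_cast
  rw [div_sub_div _ _ h0.ne' (by positivity), div_le_div_iff₀ (by positivity) (by positivity)]
  have : 0 ≤ (cumProd M i : ℝ) ^ 2 * (cumProd M i * M i) * (M i - (d + 1)) := by
    have := sub_nonneg.2 h2
    positivity
  nlinarith [this]


theorem prefixSum_add_le {c M : ℕ → ℕ} (hc : ∀ i, 2 ≤ c i) (hcM : ∀ i, c i ≤ M i) {k : ℕ}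
    {ω : ℕ → ℕ} (hω : ∀ i, k ≤ i → ω i + 2 ≤ c i) {n : ℕ} (hn : k ≤ n) :
    prefixSum c M n ω + 1 / cumProd M n ≤ prefixSum c M k ω + 1 / cumProd M k := by
  induction n, hn using Nat.le_induction with
  | base => exact le_rfl
  | succ n hn ih =>
    have h1 := digit_div_le hc hcM (i := n) (d := ω n) (by have := hω n hn; omega)
    rw [prefixSum_succ, digitTerm_of_small M (hω n hn)]
    linarith

theorem summable_digitTerm {c M : ℕ → ℕ} (hc : ∀ i, 2 ≤ c i) (hcM : ∀ i, c i ≤ M i) {k : ℕ}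
    {ω : ℕ → ℕ} (hω : ∀ i, k ≤ i → ω i + 2 ≤ c i) :
    Summable fun i => digitTerm c M i (ω i) := by
  refine summable_of_sum_range_le (c := prefixSum c M k ω + 1 / cumProd M k)
    (fun i => digitTerm_nonneg c M i _) fun n => ?_
  rcases le_total k n with hn | hn
  · refine le_trans (le_add_of_nonneg_right ?_) (prefixSum_add_le hc hcM hω hn)
    positivity
  · exact (prefixSum_mono c M ω hn).trans (le_add_of_nonneg_right (by positivity))

theorem tendsto_prefixSum {c M : ℕ → ℕ} {ω : ℕ → ℕ}
    (h : Summable fun i => digitTerm c M i (ω i)) :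
    Tendsto (fun k => prefixSum c M k ω) atTop (𝓝 (digitSum c M ω)) :=
  h.hasSum.tendsto_sum_nat

theorem prefixSum_le_digitSum {c M : ℕ → ℕ} {ω : ℕ → ℕ}
    (h : Summable fun i => digitTerm c M i (ω i)) (k : ℕ) :
    prefixSum c M k ω ≤ digitSum c M ω :=
  h.sum_le_tsum _ fun i _ => digitTerm_nonneg c M i _

theorem digitSum_le {c M : ℕ → ℕ} (hc : ∀ i, 2 ≤ c i) (hcM : ∀ i, c i ≤ M i) {k : ℕ}
    {ω : ℕ → ℕ} (hω : ∀ i, k ≤ i → ω i + 2 ≤ c i) :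
    digitSum c M ω ≤ prefixSum c M k ω + 1 / cumProd M k := by
  refine le_of_tendsto (tendsto_prefixSum (summable_digitTerm hc hcM hω)) ?_
  filter_upwards [eventually_ge_atTop k] with n hn
  refine le_trans (le_add_of_nonneg_right ?_) (prefixSum_add_le hc hcM hω hn)
  positivity

/-- Sharper than `digitSum_le`: digit `k` is below `c k`, possibly far below `M k`. This length is
the reciprocal of the scale in the Hausdorff formula. -/
theorem digitSum_le' {c M : ℕ → ℕ} (hc : ∀ i, 2 ≤ c i) (hcM : ∀ i, c i ≤ M i) {k : ℕ}
    {ω : ℕ → ℕ} (hω : ∀ i, k ≤ i → ω i + 2 ≤ c i) :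
    digitSum c M ω ≤ prefixSum c M k ω + c k / cumProd M (k + 1) := by
  have h1 := digitSum_le hc hcM (k := k + 1) fun i hi => hω i (by omega)
  rw [prefixSum_succ, digitTerm_of_small M (hω k le_rfl)] at h1
  have h2 : ((ω k : ℝ) + 1) / cumProd M (k + 1) ≤ c k / cumProd M (k + 1) := by
    gcongr
    exact_mod_cast (by have := hω k le_rfl; omega : ω k + 1 ≤ c k)
  rw [add_div] at h2
  linarith

/-- The integer with mixed radix digits `ω 0, …, ω (k - 1)` (most significant digit first). -/
def mixedRadix (M : ℕ → ℕ) (ω : ℕ → ℕ) : ℕ → ℕ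
  | 0 => 0
  | k + 1 => mixedRadix M ω k * M k + ω k

theorem mixedRadix_inj {M : ℕ → ℕ} {ω ω' : ℕ → ℕ} {k : ℕ} (h : ∀ i < k, ω i < M i)
    (h' : ∀ i < k, ω' i < M i) (heq : mixedRadix M ω k = mixedRadix M ω' k) :
    ∀ i < k, ω i = ω' i := by
  induction k with
  | zero => intro i hi; omega
  | succ k ih =>
    have hk := h k (by omega)
    have hk' := h' k (by omega)
    simp only [mixedRadix] at heq
    have h1 : ω k = ω' k := by
      have := congrArg (· % M k) heq
      simpa [Nat.add_mod, Nat.mod_eq_of_lt hk, Nat.mod_eq_of_lt hk'] using this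
    have h2 : mixedRadix M ω k = mixedRadix M ω' k := by
      rw [h1] at heq
      exact Nat.eq_of_mul_eq_mul_right (by omega) (Nat.add_right_cancel heq)
    intro i hi
    rcases Nat.lt_succ_iff_lt_or_eq.1 hi with hi | rfl
    · exact ih (fun i hi => h i (by omega)) (fun i hi => h' i (by omega)) h2 i hi
    · exact h1

/-- Unshifted prefixes lie on a grid, and by `mixedRadix_inj` distinct ones occupy distinct points;
cylinders near a ball can thus be counted. -/
theorem prefixSum_eq_mixedRadix {c M : ℕ → ℕ} (hM : ∀ i, 2 ≤ M i) {ω : ℕ → ℕ} {k : ℕ}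
    (hω : ∀ i < k, ω i + 2 ≤ c i) :
    prefixSum c M k ω = mixedRadix M ω k / cumProd M k := by
  induction k with
  | zero => simp [prefixSum, mixedRadix]
  | succ k ih =>
    rw [prefixSum_succ, digitTerm_of_small M (hω k (by omega)), ih fun i hi => hω i (by omega),
      mixedRadix]
    have h0 : (0 : ℝ) < cumProd M k := by exact_mod_cast cumProd_pos hM k
    have h1 : (0 : ℝ) < M k := by exact_mod_cast two_pos.trans_le (hM k)
    rw [cumProd_succ]
    push_cast
    field_simp

/-- Digit sequences that avoid the shifted digit from position `n` on. -/
def tameDigits (c : ℕ → ℕ) (n : ℕ) : Set (ℕ → ℕ) :=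
  {ω | (∀ i, ω i < c i) ∧ ∀ i, n ≤ i → ω i + 2 ≤ c i}

theorem isCompact_tameDigits (c : ℕ → ℕ) (n : ℕ) : IsCompact (tameDigits c n) := by
  have : tameDigits c n = Set.univ.pi fun i => {d | d < c i ∧ (n ≤ i → d + 2 ≤ c i)} := by
    ext ω
    simp only [tameDigits, Set.mem_ofPred_eq, Set.mem_pi, Set.mem_univ, true_imp_iff, forall_and]
  rw [this]
  exact isCompact_univ_pi fun i => ((Set.finite_Iio (c i)).subset fun d hd => hd.1).isCompact

/-- Past level `n` the tails are bounded uniformly, so the partial sums converge uniformly. -/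
theorem continuousOn_digitSum {c M : ℕ → ℕ} (hc : ∀ i, 2 ≤ c i) (hcM : ∀ i, c i ≤ M i) (n : ℕ) :
    ContinuousOn (digitSum c M) (tameDigits c n) := by
  have hM : ∀ i, 2 ≤ M i := fun i => (hc i).trans (hcM i)
  have hlim : Tendsto (fun k => 1 / (cumProd M k : ℝ)) atTop (𝓝 0) := by
    simpa only [one_div] using! (tendsto_cumProd_atTop hM).inv_tendsto_atTop
  have hunif : TendstoUniformlyOn (fun k ω => prefixSum c M k ω) (digitSum c M) atTop
      (tameDigits c n) := by
    rw [Metric.tendstoUniformlyOn_iff]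
    intro ε hε
    filter_upwards [hlim.eventually (gt_mem_nhds hε), eventually_ge_atTop n] with k hk hnk ω hω
    have h1 := digitSum_le hc hcM (k := k) fun i hi => hω.2 i (hnk.trans hi)
    have h2 := prefixSum_le_digitSum (summable_digitTerm hc hcM hω.2) k
    rw [Real.dist_eq, abs_of_nonneg (sub_nonneg.2 h2)]
    linarith
  refine hunif.continuousOn (Frequently.of_forall fun k => Continuous.continuousOn ?_)
  exact continuous_finsetSum _ fun i _ =>
    (continuous_of_discreteTopology (f := digitTerm c M i)).comp (continuous_apply i)

theorem isCompact_image_tameDigits {c M : ℕ → ℕ} (hc : ∀ i, 2 ≤ c i) (hcM : ∀ i, c i ≤ M i)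
    (n : ℕ) : IsCompact (digitSum c M '' tameDigits c n) :=
  (isCompact_tameDigits c n).image_of_continuousOn (continuousOn_digitSum hc hcM n)

/-! ### Independent uniform digits -/

/-- The uniform distribution on `{0, …, c i - 1}`. -/
noncomputable def digitLaw (c : ℕ → ℕ) (i : ℕ) : Measure ℕ :=
  ProbabilityTheory.uniformOn (Finset.range (c i) : Set ℕ)

instance isProbabilityMeasure_digitLaw (c : ℕ → ℕ) [hc : Fact (∀ i, 2 ≤ c i)] (i : ℕ) :
    IsProbabilityMeasure (digitLaw c i) :=
  ProbabilityTheory.isProbabilityMeasure_uniformOn (Finset.finite_toSet _)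
    ⟨0, by have := hc.out i; simp; omega⟩

/-- The law of independent uniformly distributed digits. -/
noncomputable def digitMeasure (c : ℕ → ℕ) [Fact (∀ i, 2 ≤ c i)] : Measure (ℕ → ℕ) :=
  Measure.infinitePi (digitLaw c)

instance isProbabilityMeasure_digitMeasure (c : ℕ → ℕ) [Fact (∀ i, 2 ≤ c i)] :
    IsProbabilityMeasure (digitMeasure c) := by
  unfold digitMeasure; infer_instance

theorem digitLaw_singleton {c : ℕ → ℕ} {i d : ℕ} (hd : d < c i) :
    digitLaw c i {d} = (c i : ℝ≥0∞)⁻¹ := by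
  have := ProbabilityTheory.uniformOn_apply_finset (s := Finset.range (c i)) (t := {d})
  rw [Finset.coe_singleton] at this
  rw [digitLaw, this, Finset.inter_singleton_of_mem (Finset.mem_range.2 hd)]
  simp

theorem digitMeasure_pi (c : ℕ → ℕ) [Fact (∀ i, 2 ≤ c i)] (s : Finset ℕ) {d : ℕ → ℕ}
    (hd : ∀ i ∈ s, d i < c i) :
    digitMeasure c {ω | ∀ i ∈ s, ω i = d i} = ∏ i ∈ s, (c i : ℝ≥0∞)⁻¹ := by
  have : {ω : ℕ → ℕ | ∀ i ∈ s, ω i = d i} = Set.pi (s : Set ℕ) fun i => {d i} := by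
    ext ω; simp [Set.mem_pi]
  rw [this, digitMeasure, Measure.infinitePi_pi (digitLaw c) fun i _ => measurableSet_singleton _]
  exact Finset.prod_congr rfl fun i hi => digitLaw_singleton (hd i hi)

theorem digitMeasure_cylinder (c : ℕ → ℕ) [Fact (∀ i, 2 ≤ c i)] (k : ℕ) {d : ℕ → ℕ}
    (hd : ∀ i < k, d i < c i) :
    digitMeasure c {ω | ∀ i < k, ω i = d i} = (cumProd c k : ℝ≥0∞)⁻¹ := by
  have := digitMeasure_pi c (Finset.range k) fun i hi => hd i (Finset.mem_range.1 hi)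
  simp only [Finset.mem_range] at this
  rw [this, cumProd, Nat.cast_prod, ENNReal.prod_inv_distrib]
  exact fun i _ j _ _ => Or.inr (ENNReal.natCast_ne_top _)

theorem ae_digit_lt (c : ℕ → ℕ) [hc : Fact (∀ i, 2 ≤ c i)] :
    ∀ᵐ ω ∂digitMeasure c, ∀ i, ω i < c i := by
  rw [ae_all_iff]
  intro i
  have h1 : ∀ᵐ d ∂digitLaw c i, d < c i := by
    rw [ae_iff_measure_eq (by exact (MeasurableSet.of_discrete).nullMeasurableSet), measure_univ]
    have : {d | d < c i} = (Finset.range (c i) : Set ℕ) := by ext; simp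
    rw [this]
    exact ProbabilityTheory.uniformOn_self (Finset.finite_toSet _)
      ⟨0, by have := hc.out i; simp; omega⟩
  exact (measurePreserving_eval_infinitePi (digitLaw c) i).quasiMeasurePreserving.ae h1

theorem digitMeasure_last (c : ℕ → ℕ) [hc : Fact (∀ i, 2 ≤ c i)] (i : ℕ) :
    digitMeasure c {ω | ω i + 1 = c i} = (c i : ℝ≥0∞)⁻¹ := by
  have h2 := hc.out i
  have := digitMeasure_pi c {i} (d := fun i => c i - 1) (by simp; omega)
  simp only [Finset.mem_singleton, forall_eq, Finset.prod_singleton] at this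
  rw [← this]
  congr 1
  ext ω
  exact ⟨fun h => by simp at h ⊢; omega, fun h => by simp at h ⊢; omega⟩

theorem tsum_inv_ne_top {c : ℕ → ℕ} (hc : ∀ i, 2 ≤ c i) (hsum : Summable fun i => 1 / (c i : ℝ)) :
    ∑' i, (c i : ℝ≥0∞)⁻¹ ≠ ∞ := by
  have h := hsum.tsum_ofReal_ne_top
  convert h using 4 with i
  have : (0 : ℝ) < c i := by exact_mod_cast two_pos.trans_le (hc i)
  rw [one_div, ENNReal.ofReal_inv_of_pos this, ENNReal.ofReal_natCast]

/-- Borel–Cantelli: the shifted digit at position `i` has probability `1 / c i`. -/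
theorem ae_mem_iUnion_tameDigits (c : ℕ → ℕ) [hc : Fact (∀ i, 2 ≤ c i)]
    (hsum : Summable fun i => 1 / (c i : ℝ)) :
    ∀ᵐ ω ∂digitMeasure c, ∃ n, ω ∈ tameDigits c n := by
  have h1 : ∑' i, digitMeasure c {ω | ω i + 1 = c i} ≠ ∞ := by
    simp only [digitMeasure_last]
    exact tsum_inv_ne_top hc.out hsum
  filter_upwards [ae_eventually_notMem h1, ae_digit_lt c] with ω hω hlt
  obtain ⟨n, hn⟩ := eventually_atTop.1 hω
  refine ⟨n, hlt, fun i hi => ?_⟩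
  have h2 := hn i hi
  have h3 := hlt i
  omega

theorem ae_summable_digitTerm {c M : ℕ → ℕ} [hc : Fact (∀ i, 2 ≤ c i)] (hcM : ∀ i, c i ≤ M i)
    (hsum : Summable fun i => 1 / (c i : ℝ)) :
    ∀ᵐ ω ∂digitMeasure c, Summable fun i => digitTerm c M i (ω i) := by
  filter_upwards [ae_mem_iUnion_tameDigits c hsum] with ω ⟨n, hn⟩
  exact summable_digitTerm hc.out hcM hn.2

theorem measurable_prefixSum (c M : ℕ → ℕ) (k : ℕ) : Measurable (prefixSum c M k) :=
  Finset.measurable_sum _ fun i _ =>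
    (measurable_of_countable (digitTerm c M i)).comp (measurable_pi_apply i)

theorem aemeasurable_digitSum {c M : ℕ → ℕ} [Fact (∀ i, 2 ≤ c i)] (hcM : ∀ i, c i ≤ M i)
    (hsum : Summable fun i => 1 / (c i : ℝ)) :
    AEMeasurable (digitSum c M) (digitMeasure c) := by
  refine aemeasurable_of_tendsto_metrizable_ae atTop
    (fun k => (measurable_prefixSum c M k).aemeasurable) ?_
  filter_upwards [ae_summable_digitTerm hcM hsum] with ω hω using tendsto_prefixSum hω

/-- Given the first `k` digits, a later shift has probability at most the tail of `∑ 1 / c i`,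
eventually below one half, uniformly in the prefix. -/
theorem eventually_le_digitMeasure_cylinder_tame (c : ℕ → ℕ) [hc : Fact (∀ i, 2 ≤ c i)]
    (hsum : Summable fun i => 1 / (c i : ℝ)) :
    ∀ᶠ k in atTop, ∀ d : ℕ → ℕ, (∀ i < k, d i < c i) →
      (cumProd c k : ℝ≥0∞)⁻¹ / 2 ≤
        digitMeasure c ({ω | ∀ i < k, ω i = d i} ∩ tameDigits c k) := by
  have hlim : Tendsto (fun k => ∑' j, (c (j + k) : ℝ≥0∞)⁻¹) atTop (𝓝 0) :=
    ENNReal.tendsto_sum_nat_add _ (tsum_inv_ne_top hc.out hsum)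
  have h2 : (0 : ℝ≥0∞) < 2⁻¹ := by simp
  filter_upwards [hlim.eventually (gt_mem_nhds h2)] with k hk d hd
  set A := {ω : ℕ → ℕ | ∀ i < k, ω i = d i} with hA
  have hB : (cumProd c k : ℝ≥0∞)⁻¹ ≠ ∞ := by
    simpa using (cumProd_pos hc.out k).ne'
  have hbad : ∀ j, digitMeasure c (A ∩ {ω | ω (j + k) + 1 = c (j + k)}) =
      (cumProd c k : ℝ≥0∞)⁻¹ * (c (j + k) : ℝ≥0∞)⁻¹ := by
    intro j
    have hnot : j + k ∉ Finset.range k := by simp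
    have h3 := digitMeasure_pi c (insert (j + k) (Finset.range k))
      -- Prescribing the prefix and a shift at `j + k` is again a cylinder event, so independence
      -- gives its probability.
      (d := fun i => if i < k then d i else c i - 1) (by
        intro i _
        have := hc.out i
        by_cases hik : i < k
        · simpa [hik] using hd i hik
        · simp only [hik, if_false]; omega)
    have h4 : A ∩ {ω | ω (j + k) + 1 = c (j + k)} =
        {ω | ∀ i ∈ insert (j + k) (Finset.range k),
          ω i = if i < k then d i else c i - 1} := by
      ext ω
      have := hc.out (j + k)
      simp only [hA, Set.mem_inter_iff, Set.mem_ofPred_eq, Finset.mem_insert, Finset.mem_range,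
        forall_eq_or_imp]
      rw [if_neg (by omega), and_comm]
      refine and_congr (by omega) (forall₂_congr fun i hi => ?_)
      rw [if_pos hi]
    rw [h4, h3, Finset.prod_insert hnot, mul_comm, cumProd, Nat.cast_prod,
      ENNReal.prod_inv_distrib]
    exact fun i _ j _ _ => Or.inr (ENNReal.natCast_ne_top _)
  have hcover : digitMeasure c A ≤ digitMeasure c (A ∩ tameDigits c k) +
      ∑' j, digitMeasure c (A ∩ {ω | ω (j + k) + 1 = c (j + k)}) := by
    calc digitMeasure c A ≤ digitMeasure c ((A ∩ tameDigits c k) ∪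
          ⋃ j, A ∩ {ω | ω (j + k) + 1 = c (j + k)}) := by
          refine measure_mono_ae ?_
          filter_upwards [ae_digit_lt c] with ω hlt hω
          by_cases h : ω ∈ tameDigits c k
          · exact Or.inl ⟨hω, h⟩
          · refine Or.inr ?_
            simp only [tameDigits, Set.mem_ofPred_eq, not_and, not_forall] at h
            obtain ⟨i, hi, hi'⟩ := h hlt
            refine Set.mem_iUnion.2 ⟨i - k, hω, ?_⟩
            have := hlt i
            simp only [Set.mem_ofPred_eq, Nat.sub_add_cancel hi]
            omega
      _ ≤ _ := (measure_union_le _ _).trans (add_le_add_right (measure_iUnion_le _) _)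
  simp only [hbad, ENNReal.tsum_mul_left, digitMeasure_cylinder c k hd, A] at hcover
  have h5 : (cumProd c k : ℝ≥0∞)⁻¹ * ∑' j, (c (j + k) : ℝ≥0∞)⁻¹ ≤ (cumProd c k : ℝ≥0∞)⁻¹ / 2 := by
    rw [div_eq_mul_inv]; gcongr
  have h6 : (cumProd c k : ℝ≥0∞)⁻¹ / 2 + (cumProd c k : ℝ≥0∞)⁻¹ / 2 ≤
      digitMeasure c ({ω | ∀ i < k, ω i = d i} ∩ tameDigits c k) +
        (cumProd c k : ℝ≥0∞)⁻¹ / 2 := by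
    rw [ENNReal.add_halves]
    exact hcover.trans (add_le_add_right h5 _)
  exact ENNReal.le_of_add_le_add_right (ENNReal.div_ne_top hB two_ne_zero) h6

/-! ### The unshifted measure and the support of the limit law -/

/-- The image under `digitSum` of the digit measure restricted to sequences without shifts. -/
noncomputable def tameMeasure (c M : ℕ → ℕ) [Fact (∀ i, 2 ≤ c i)] : Measure ℝ :=
  ((digitMeasure c).restrict (tameDigits c 0)).map (digitSum c M)

theorem digitMeasure_mixedRadix_le {c M : ℕ → ℕ} [hc : Fact (∀ i, 2 ≤ c i)]
    (hcM : ∀ i, c i ≤ M i) (k j : ℕ) :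
    digitMeasure c {ω | (∀ i, ω i < c i) ∧ mixedRadix M ω k = j} ≤ (cumProd c k : ℝ≥0∞)⁻¹ := by
  by_cases h : ∃ d : ℕ → ℕ, (∀ i, d i < c i) ∧ mixedRadix M d k = j
  · obtain ⟨d, hd, hdj⟩ := h
    rw [← digitMeasure_cylinder c k fun i _ => hd i]
    refine measure_mono fun ω hω => ?_
    exact mixedRadix_inj (fun i _ => (hω.1 i).trans_le (hcM i))
      (fun i _ => (hd i).trans_le (hcM i)) (hω.2.trans hdj.symm)
  · push Not at h
    have : {ω | (∀ i, ω i < c i) ∧ mixedRadix M ω k = j} = ∅ := by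
      ext ω; simpa using h ω
    simp [this]

/-- A level-`k` cylinder with index `j` maps into `[j, j + 1]` divided by `cumProd M k`; at most `2
* r * cumProd M k + 2` integers `j` qualify, each of mass at most `1 / cumProd c k`. -/
theorem tameMeasure_closedBall_le {c M : ℕ → ℕ} [hc : Fact (∀ i, 2 ≤ c i)]
    (hcM : ∀ i, c i ≤ M i) (hsum : Summable fun i => 1 / (c i : ℝ)) (k : ℕ) (x : ℝ) {r : ℝ}
    (hr : 0 ≤ r) :
    tameMeasure c M (Metric.closedBall x r) ≤
      ENNReal.ofReal ((2 * r * cumProd M k + 2) / cumProd c k) := by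
  have hM : ∀ i, 2 ≤ M i := fun i => (hc.out i).trans (hcM i)
  have hP : (0 : ℝ) < cumProd M k := by exact_mod_cast cumProd_pos hM k
  have hB : (0 : ℝ) < cumProd c k := by exact_mod_cast cumProd_pos hc.out k
  set I : Finset ℤ := Finset.Icc ⌈(x - r) * cumProd M k - 1⌉ ⌊(x + r) * cumProd M k⌋ with hI
  rw [tameMeasure, Measure.map_apply_of_aemeasurable
    (aemeasurable_digitSum hcM hsum).restrict Metric.isClosed_closedBall.measurableSet,
    Measure.restrict_apply' (isCompact_tameDigits c 0).measurableSet]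
  -- Negative `j` in `I` become `0` under `toNat`; these repeated terms only weaken the upper bound.
  have hsub : digitSum c M ⁻¹' Metric.closedBall x r ∩ tameDigits c 0 ⊆
      ⋃ j ∈ I, {ω | (∀ i, ω i < c i) ∧ mixedRadix M ω k = j.toNat} := by
    rintro ω ⟨hω, hlt, hsm⟩
    have hsm' : ∀ i, ω i + 2 ≤ c i := fun i => hsm i (Nat.zero_le i)
    have h1 := prefixSum_le_digitSum (summable_digitTerm hc.out hcM (k := 0) hsm) k
    have h2 := digitSum_le hc.out hcM (k := k) fun i _ => hsm' i
    rw [prefixSum_eq_mixedRadix hM fun i _ => hsm' i] at h1 h2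
    rw [Set.mem_preimage, Metric.mem_closedBall, Real.dist_eq, abs_le] at hω
    rw [div_le_iff₀ hP] at h1
    rw [← add_div, le_div_iff₀ hP] at h2
    refine Set.mem_biUnion (x := (mixedRadix M ω k : ℤ)) ?_ ⟨hlt, by simp⟩
    have h3 : digitSum c M ω * cumProd M k ≤ (x + r) * cumProd M k := by gcongr; linarith
    have h4 : (x - r) * cumProd M k ≤ digitSum c M ω * cumProd M k := by gcongr; linarith
    rw [hI, Finset.mem_coe, Finset.mem_Icc, Int.ceil_le, Int.le_floor]
    constructor <;> push_cast <;> linarith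
  have hcard : (I.card : ℝ) ≤ 2 * r * cumProd M k + 2 := by
    rw [hI, Int.card_Icc]
    have h1 := Int.floor_le ((x + r) * cumProd M k)
    have h2 := Int.le_ceil ((x - r) * cumProd M k - 1)
    have h3 : (((⌊(x + r) * cumProd M k⌋ + 1 - ⌈(x - r) * cumProd M k - 1⌉).toNat : ℤ) : ℝ) =
        ((max (⌊(x + r) * cumProd M k⌋ + 1 - ⌈(x - r) * cumProd M k - 1⌉) 0 : ℤ) : ℝ) := by
      rw [Int.toNat_eq_max]
    rw [Int.cast_natCast] at h3
    rw [h3]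
    push_cast
    refine max_le ?_ (by positivity)
    nlinarith
  calc _ ≤ ∑ j ∈ I, digitMeasure c {ω | (∀ i, ω i < c i) ∧ mixedRadix M ω k = j.toNat} :=
        (measure_mono hsub).trans (measure_biUnion_finset_le _ _)
    _ ≤ ∑ _ ∈ I, (cumProd c k : ℝ≥0∞)⁻¹ :=
        Finset.sum_le_sum fun j _ => digitMeasure_mixedRadix_le hcM k _
    _ = ENNReal.ofReal (I.card / cumProd c k) := by
        rw [Finset.sum_const, nsmul_eq_mul, ENNReal.ofReal_div_of_pos hB, ENNReal.ofReal_natCast,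
          ENNReal.ofReal_natCast, div_eq_mul_inv]
    _ ≤ _ := by gcongr

/-- A prefix of zeros contains no shift, and for a long one the tail avoids shifts with probability
at least one half. -/
theorem tameMeasure_univ_ne_zero {c M : ℕ → ℕ} [hc : Fact (∀ i, 2 ≤ c i)]
    (hcM : ∀ i, c i ≤ M i) (hsum : Summable fun i => 1 / (c i : ℝ)) :
    tameMeasure c M Set.univ ≠ 0 := by
  rw [tameMeasure, Measure.map_apply_of_aemeasurable
    (aemeasurable_digitSum hcM hsum).restrict MeasurableSet.univ, Set.preimage_univ,
    Measure.restrict_apply_univ]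
  obtain ⟨k, hk⟩ := (eventually_le_digitMeasure_cylinder_tame c hsum).exists
  have h0 : ∀ i, 0 < c i := fun i => two_pos.trans_le (hc.out i)
  have h1 := hk (fun _ => 0) fun i _ => h0 i
  have h2 : {ω | ∀ i < k, ω i = (fun _ => 0 : ℕ → ℕ) i} ∩ tameDigits c k ⊆ tameDigits c 0 := by
    rintro ω ⟨hω, hlt, hsm⟩
    refine ⟨hlt, fun i _ => ?_⟩
    rcases lt_or_ge i k with hi | hi
    · rw [hω i hi]; simpa using hc.out i
    · exact hsm i hi
  refine ((lt_of_lt_of_le ?_ h1).trans_le (measure_mono h2)).ne'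
  exact ENNReal.div_pos (by simp) (by simp)

/-- The distribution of the random number whose digits are independent and uniform. -/
noncomputable def digitSumLaw (c M : ℕ → ℕ) [Fact (∀ i, 2 ≤ c i)] : Measure ℝ :=
  (digitMeasure c).map (digitSum c M)

instance isFiniteMeasure_digitSumLaw (c M : ℕ → ℕ) [Fact (∀ i, 2 ≤ c i)] :
    IsFiniteMeasure (digitSumLaw c M) := by
  unfold digitSumLaw; infer_instance

theorem digitSumLaw_apply {c M : ℕ → ℕ} [Fact (∀ i, 2 ≤ c i)] (hcM : ∀ i, c i ≤ M i)
    (hsum : Summable fun i => 1 / (c i : ℝ)) {A : Set ℝ} (hA : MeasurableSet A) :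
    digitSumLaw c M A = digitMeasure c (digitSum c M ⁻¹' A) :=
  Measure.map_apply_of_aemeasurable (aemeasurable_digitSum hcM hsum) hA

theorem tameMeasure_support_ne_zero {c M : ℕ → ℕ} [hc : Fact (∀ i, 2 ≤ c i)]
    (hcM : ∀ i, c i ≤ M i) (hsum : Summable fun i => 1 / (c i : ℝ)) :
    tameMeasure c M (digitSumLaw c M).support ≠ 0 := by
  have hX := aemeasurable_digitSum hcM hsum
  have h0 : tameMeasure c M (digitSumLaw c M).supportᶜ = 0 := by
    have h1 := Measure.measure_compl_support (μ := digitSumLaw c M)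
    have hm := (Measure.isOpen_compl_support (μ := digitSumLaw c M)).measurableSet
    rw [digitSumLaw_apply hcM hsum hm] at h1
    rw [tameMeasure, Measure.map_apply_of_aemeasurable hX.restrict hm]
    exact le_antisymm ((Measure.restrict_apply_le _ _).trans_eq h1) zero_le
  intro h
  refine tameMeasure_univ_ne_zero hcM hsum ?_
  rw [← Set.union_compl_self (digitSumLaw c M).support]
  exact measure_union_null h h0

/-- All terms are nonnegative, so a sum below `(n + 1)!` has no shift from position `n` on. Near `x
< (n + 1)!` the law thus lives on a compact set, which must contain `x`. -/
theorem support_digitSumLaw_subset {c M : ℕ → ℕ} [hc : Fact (∀ i, 2 ≤ c i)]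
    (hcM : ∀ i, c i ≤ M i) (hsum : Summable fun i => 1 / (c i : ℝ)) :
    (digitSumLaw c M).support ⊆ ⋃ n, digitSum c M '' tameDigits c n := by
  intro x hx
  obtain ⟨n, hn⟩ := exists_nat_gt x
  have hxn : x < ((n + 1).factorial : ℝ) :=
    hn.trans_le (by exact_mod_cast (Nat.le_succ n).trans (Nat.self_le_factorial _))
  refine Set.mem_iUnion.2 ⟨n, ?_⟩
  by_contra hxK
  have hU : IsOpen (Set.Iio ((n + 1).factorial : ℝ) ∩ (digitSum c M '' tameDigits c n)ᶜ) :=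
    isOpen_Iio.inter (isCompact_image_tameDigits hc.out hcM n).isClosed.isOpen_compl
  refine absurd hx (Measure.notMem_support_iff_exists.2 ⟨_, hU.mem_nhds ⟨hxn, hxK⟩, ?_⟩)
  rw [digitSumLaw_apply hcM hsum hU.measurableSet, measure_eq_zero_iff_ae_notMem]
  filter_upwards [ae_digit_lt c, ae_summable_digitTerm hcM hsum] with ω hlt hs
  rintro ⟨h1, h2⟩
  refine h2 ⟨ω, ⟨hlt, fun i hi => ?_⟩, rfl⟩
  by_contra hsmall
  have h3 := factorial_le_digitTerm M (show ω i + 1 = c i by have := hlt i; omega)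
  have h4 : digitTerm c M i (ω i) ≤ digitSum c M ω :=
    hs.le_tsum i fun j _ => digitTerm_nonneg c M j _
  have h5 : ((n + 1).factorial : ℝ) ≤ (i + 1).factorial := by
    exact_mod_cast Nat.factorial_le (by omega)
  exact absurd (h5.trans (h3.trans h4)) (not_le.2 h1)

/-! ### Covering and ball estimates at intermediate scales -/

/-- The scale `P (k + 1) / c k`, where `P k = M 0 ⋯ M (k - 1)`. -/
noncomputable def coverScale (c M : ℕ → ℕ) (k : ℕ) : ℝ := cumProd M (k + 1) / c k

theorem cumProd_le_coverScale {c M : ℕ → ℕ} (hc : ∀ i, 2 ≤ c i) (hcM : ∀ i, c i ≤ M i) (k : ℕ) :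
    (cumProd M k : ℝ) ≤ coverScale c M k := by
  have : (0 : ℝ) < c k := by exact_mod_cast two_pos.trans_le (hc k)
  rw [coverScale, le_div_iff₀ this, cumProd_succ]
  exact_mod_cast Nat.mul_le_mul_left _ (hcM k)

theorem tendsto_coverScale_atTop {c M : ℕ → ℕ} (hc : ∀ i, 2 ≤ c i) (hcM : ∀ i, c i ≤ M i) :
    Tendsto (coverScale c M) atTop atTop :=
  tendsto_atTop_mono (cumProd_le_coverScale hc hcM)
    (tendsto_cumProd_atTop fun i => (hc i).trans (hcM i))

/-- Monotonicity of `f` is not needed: take the least `k ≥ k₀` with `a / f (k + 1) < r`; minimality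
gives the other bound. -/
theorem exists_scale {f : ℕ → ℝ} (hf : Tendsto f atTop atTop) {a r : ℝ} (hr : 0 < r)
    {k₀ : ℕ} (hk₀ : r ≤ a / f k₀) :
    ∃ k, k₀ ≤ k ∧ r ≤ a / f k ∧ a / f (k + 1) < r := by
  have hex : ∃ k, k₀ ≤ k ∧ a / f (k + 1) < r := by
    have h1 : Tendsto (fun k => a / f (k + 1)) atTop (𝓝 0) :=
      tendsto_const_nhds.div_atTop (hf.comp (tendsto_add_atTop_nat 1))
    exact ((eventually_ge_atTop k₀).and (h1.eventually (gt_mem_nhds hr))).exists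
  classical
  obtain ⟨h1, h2⟩ := Nat.find_spec hex
  refine ⟨Nat.find hex, h1, ?_, h2⟩
  rcases h1.eq_or_lt with h | h
  · rwa [← h]
  · have h3 := Nat.find_min hex (m := Nat.find hex - 1) (by omega)
    rw [not_and, not_lt, Nat.sub_add_cancel (by omega)] at h3
    exact h3 (by omega)

/-- Between consecutive grid scales the critical radius is `1 / coverScale c M k`. Above it,
boundedly many level-`k` cylinders are counted; below it, the level-`k + 1` count is linear in `r`,
and `s ≤ 1` turns this into `r ^ s`. -/
theorem tameMeasure_closedBall_le_rpow {c M : ℕ → ℕ} [hc : Fact (∀ i, 2 ≤ c i)]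
    (hcM : ∀ i, c i ≤ M i) (hsum : Summable fun i => 1 / (c i : ℝ)) {s : ℝ} (hs0 : 0 ≤ s)
    (hs1 : s ≤ 1) {k₀ : ℕ} (h : ∀ k, k₀ ≤ k → coverScale c M k ^ s ≤ cumProd c k) (x : ℝ) {r : ℝ}
    (hr : 0 < r) (hr₀ : r ≤ 1 / cumProd M k₀) :
    tameMeasure c M (Metric.closedBall x r) ≤ ENNReal.ofReal (4 * r ^ s) := by
  have hM : ∀ i, 2 ≤ M i := fun i => (hc.out i).trans (hcM i)
  obtain ⟨k, hk, hrk, hrk'⟩ := exists_scale (tendsto_cumProd_atTop hM) hr hr₀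
  have hP : ∀ k, (0 : ℝ) < cumProd M k := fun k => by exact_mod_cast cumProd_pos hM k
  have hB : (0 : ℝ) < cumProd c k := by exact_mod_cast cumProd_pos hc.out k
  have hck : (0 : ℝ) < c k := by exact_mod_cast two_pos.trans_le (hc.out k)
  have hQ : 0 < coverScale c M k := div_pos (hP _) hck
  rw [le_div_iff₀ (hP k)] at hrk
  rw [div_lt_iff₀ (hP _)] at hrk'
  have key : (r * coverScale c M k) ^ s / cumProd c k ≤ r ^ s := by
    rw [Real.mul_rpow hr.le hQ.le, div_le_iff₀ hB]
    have := h k hk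
    gcongr
  rcases le_total 1 (r * coverScale c M k) with h1 | h1
  · refine (tameMeasure_closedBall_le hcM hsum k x hr.le).trans (ENNReal.ofReal_le_ofReal ?_)
    have h2 : 1 ≤ (r * coverScale c M k) ^ s := Real.one_le_rpow h1 hs0
    calc (2 * r * cumProd M k + 2) / cumProd c k
        ≤ 4 * (r * coverScale c M k) ^ s / cumProd c k := by gcongr; linarith
      _ ≤ _ := by rw [mul_div_assoc]; gcongr
  · refine (tameMeasure_closedBall_le hcM hsum (k + 1) x hr.le).trans
      (ENNReal.ofReal_le_ofReal ?_)
    have h2 : r * coverScale c M k ≤ (r * coverScale c M k) ^ s :=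
      Real.self_le_rpow_of_le_one (by positivity) h1 hs1
    calc (2 * r * cumProd M (k + 1) + 2) / cumProd c (k + 1)
        ≤ 4 * (r * cumProd M (k + 1)) / cumProd c (k + 1) := by gcongr; linarith
      _ = 4 * (r * coverScale c M k / cumProd c k) := by
        rw [cumProd_succ c, coverScale]; push_cast; field_simp
      _ ≤ 4 * ((r * coverScale c M k) ^ s / cumProd c k) := by gcongr
      _ ≤ _ := by gcongr

/-- By `digitSum_le'`, one interval of length `1 / coverScale c M k` per prefix covers the set once
`k ≥ n`. The sums are at most `coverScale c M k ^ (t - s)` for infinitely many `k`, which suffices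
for the liminf. -/
theorem hausdorffMeasure_image_tameDigits_eq_zero {c M : ℕ → ℕ} (hc : ∀ i, 2 ≤ c i)
    (hcM : ∀ i, c i ≤ M i) {s t : ℝ} (hst : t < s)
    (h : ∃ᶠ k in atTop, (cumProd c k : ℝ) ≤ coverScale c M k ^ t) (n : ℕ) :
    Measure.hausdorffMeasure s (digitSum c M '' tameDigits c n) = 0 := by
  have hM : ∀ i, 2 ≤ M i := fun i => (hc i).trans (hcM i)
  have hQ : ∀ k, 0 < coverScale c M k := fun k =>
    (by exact_mod_cast cumProd_pos hM k : (0 : ℝ) < cumProd M k).trans_le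
      (cumProd_le_coverScale hc hcM k)
  have hQlim := tendsto_coverScale_atTop hc hcM
  let ext : ∀ k, (∀ i : Fin k, Fin (c i)) → ℕ → ℕ := fun k d i =>
    if hi : i < k then d ⟨i, hi⟩ else 0
  let T : ∀ k, (∀ i : Fin k, Fin (c i)) → Set ℝ := fun k d =>
    Set.Icc (prefixSum c M k (ext k d)) (prefixSum c M k (ext k d) + 1 / coverScale c M k)
  have hdiam : ∀ k d, Metric.ediam (T k d) = ENNReal.ofReal (1 / coverScale c M k) := by
    intro k d
    simp only [T, Real.ediam_Icc, add_sub_cancel_left]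
  have hr : Tendsto (fun k => ENNReal.ofReal (1 / coverScale c M k)) atTop (𝓝 0) := by
    have := ENNReal.tendsto_ofReal (tendsto_const_nhds.div_atTop hQlim (a := (1 : ℝ)))
    simpa using this
  have hcov : ∀ᶠ k in atTop, digitSum c M '' tameDigits c n ⊆ ⋃ d, T k d := by
    filter_upwards [eventually_ge_atTop n] with k hk
    rintro _ ⟨ω, hω, rfl⟩
    refine Set.mem_iUnion.2 ⟨fun i => ⟨ω i, hω.1 i⟩, ?_⟩
    have hpre : prefixSum c M k (ext k fun i => ⟨ω i, hω.1 i⟩) = prefixSum c M k ω :=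
      prefixSum_congr c M fun i hi => by simp [ext, hi]
    simp only [T, hpre, coverScale, one_div_div]
    exact ⟨prefixSum_le_digitSum (summable_digitTerm hc hcM hω.2) k,
      digitSum_le' hc hcM fun i hi => hω.2 i (hk.trans hi)⟩
  have hmain := Measure.hausdorffMeasure_le_liminf_sum s (digitSum c M '' tameDigits c n)
    (fun k => ENNReal.ofReal (1 / coverScale c M k)) hr T
    (Eventually.of_forall fun k d => (hdiam k d).le) hcov
  refine le_antisymm (hmain.trans (le_of_forall_gt fun ε hε => ?_)) zero_le
  obtain ⟨ε', hε'0, hε'⟩ := exists_between hε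
  refine lt_of_le_of_lt (liminf_le_of_frequently_le' ?_) hε'
  have hlim : Tendsto (fun k => ENNReal.ofReal (coverScale c M k ^ (t - s))) atTop (𝓝 0) := by
    have := ENNReal.tendsto_ofReal ((tendsto_rpow_neg_atTop (sub_pos.2 hst)).comp hQlim)
    simpa [Function.comp_def] using this
  refine (h.and_eventually (hlim.eventually (gt_mem_nhds hε'0))).mono fun k hk => ?_
  refine le_trans ?_ hk.2.le
  have hcard : (Fintype.card (∀ i : Fin k, Fin (c i)) : ℝ≥0∞) =
      ENNReal.ofReal (cumProd c k : ℝ) := by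
    rw [Fintype.card_pi, ENNReal.ofReal_natCast, cumProd, Finset.prod_range]
    simp
  simp only [hdiam, Finset.sum_const, nsmul_eq_mul, Finset.card_univ]
  rw [hcard, ENNReal.ofReal_rpow_of_pos (one_div_pos.2 (hQ k)),
    ← ENNReal.ofReal_mul (Nat.cast_nonneg _)]
  refine ENNReal.ofReal_le_ofReal ?_
  rw [Real.rpow_sub (hQ k), one_div, Real.inv_rpow (hQ k).le, ← div_eq_mul_inv]
  gcongr
  · exact (Real.rpow_pos_of_pos (hQ k) s).le
  · exact hk.1

/-- Moving digit `k` of the centre by at most `m` within the unshifted digits, with an unshifted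
tail, stays in the ball; each choice has at least half the mass of its cylinder. -/
theorem le_digitSumLaw_closedBall {c M : ℕ → ℕ} [hc : Fact (∀ i, 2 ≤ c i)]
    (hcM : ∀ i, c i ≤ M i) (hsum : Summable fun i => 1 / (c i : ℝ)) {k m : ℕ}
    (hk : ∀ d : ℕ → ℕ, (∀ i < k + 1, d i < c i) →
      (cumProd c (k + 1) : ℝ≥0∞)⁻¹ / 2 ≤
        digitMeasure c ({ω | ∀ i < k + 1, ω i = d i} ∩ tameDigits c (k + 1)))
    {r : ℝ} (hm : ((m : ℝ) + 1) / cumProd M (k + 1) ≤ r) {x : ℝ}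
    (hx : x ∈ digitSum c M '' tameDigits c k) :
    ((min m (c k - 2) + 1 : ℕ) : ℝ≥0∞) * ((cumProd c (k + 1) : ℝ≥0∞)⁻¹ / 2) ≤
      digitSumLaw c M (Metric.closedBall x r) := by
  obtain ⟨ω₀, hω₀, rfl⟩ := hx
  have hM : ∀ i, 2 ≤ M i := fun i => (hc.out i).trans (hcM i)
  have hP : (0 : ℝ) < cumProd M (k + 1) := by exact_mod_cast cumProd_pos hM (k + 1)
  have hck := hc.out k
  have hdk := hω₀.2 k le_rfl
  set m' := min m (c k - 2) with hm'
  -- The window `[lo, lo + m']` contains `ω₀ k` and fits inside `[0, c k - 2]`.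
  set lo := min (ω₀ k) (c k - 2 - m') with hlo
  let d : ℕ → ℕ → ℕ := fun e => Function.update ω₀ k e
  let G : ℕ → Set (ℕ → ℕ) := fun e => {ω | ∀ i < k + 1, ω i = d e i} ∩ tameDigits c (k + 1)
  have hGmeas : ∀ e, MeasurableSet (G e) := by
    intro e
    refine MeasurableSet.inter ?_ (isCompact_tameDigits c _).measurableSet
    have : {ω : ℕ → ℕ | ∀ i < k + 1, ω i = d e i} = Set.pi (Set.Iio (k + 1)) fun i => {d e i} := by
      ext ω; simp [Set.mem_pi]
    rw [this]
    exact MeasurableSet.pi (Set.to_countable _) fun i _ => measurableSet_singleton _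
  have hdisj : (Finset.Icc lo (lo + m') : Set ℕ).PairwiseDisjoint G := by
    intro e _ e' _ hee'
    refine Set.disjoint_left.2 fun ω h1 h2 => hee' ?_
    have h3 := h1.1 k (by omega)
    have h4 := h2.1 k (by omega)
    simp only [d, Function.update_self] at h3 h4
    exact h3.symm.trans h4
  have hsub : ⋃ e ∈ Finset.Icc lo (lo + m'), G e ⊆
      digitSum c M ⁻¹' Metric.closedBall (digitSum c M ω₀) r := by
    refine Set.iUnion₂_subset fun e he ω hω => ?_
    rw [Finset.mem_Icc] at he
    have h1 := prefixSum_le_digitSum (summable_digitTerm hc.out hcM (M := M) hω.2.2) (k + 1)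
    have h2 := digitSum_le hc.out hcM (M := M) hω.2.2
    have h3 := prefixSum_le_digitSum (summable_digitTerm hc.out hcM (M := M) hω₀.2) (k + 1)
    have h4 := digitSum_le hc.out hcM (M := M) (k := k + 1) fun i hi => hω₀.2 i (by omega)
    have h5 : ω k = e := by simpa [d] using hω.1 k (by omega)
    have h6 : prefixSum c M k ω = prefixSum c M k ω₀ := prefixSum_congr c M fun i hi => by
      simpa [d, hi.ne] using hω.1 i (by omega)
    rw [prefixSum_succ, h5, h6, digitTerm_of_small M (by omega)] at h1 h2
    rw [prefixSum_succ, digitTerm_of_small M hdk] at h3 h4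
    have h7 : (e : ℝ) / cumProd M (k + 1) ≤ ω₀ k / cumProd M (k + 1) + m / cumProd M (k + 1) := by
      rw [← add_div]
      gcongr
      exact_mod_cast (by omega : e ≤ ω₀ k + m)
    have h8 : (ω₀ k : ℝ) / cumProd M (k + 1) ≤ e / cumProd M (k + 1) + m / cumProd M (k + 1) := by
      rw [← add_div]
      gcongr
      exact_mod_cast (by omega : ω₀ k ≤ e + m)
    rw [add_div] at hm
    rw [Set.mem_preimage, Metric.mem_closedBall, Real.dist_eq, abs_le]
    constructor <;> linarith
  rw [digitSumLaw_apply hcM hsum Metric.isClosed_closedBall.measurableSet]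
  refine le_trans ?_ (measure_mono hsub)
  rw [measure_biUnion_finset hdisj fun e _ => hGmeas e]
  have hcard : (Finset.Icc lo (lo + m')).card = m' + 1 := by
    rw [Nat.card_Icc]; omega
  rw [← hcard, ← nsmul_eq_mul, ← Finset.sum_const]
  refine Finset.sum_le_sum fun e he => hk (d e) fun i hi => ?_
  rw [Finset.mem_Icc] at he
  rcases eq_or_ne i k with rfl | hik
  · simp only [d, Function.update_self]; omega
  · simpa [d, hik] using hω₀.1 i

theorem rpow_le_digitSumLaw_closedBall {c M : ℕ → ℕ} [hc : Fact (∀ i, 2 ≤ c i)]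
    (hcM : ∀ i, c i ≤ M i) (hsum : Summable fun i => 1 / (c i : ℝ)) {t : ℝ} (ht0 : 0 ≤ t)
    (ht1 : t ≤ 1) (h : ∀ᶠ k in atTop, (cumProd c k : ℝ) ≤ (cumProd M k : ℝ) ^ t) (n : ℕ) :
    ∃ δ : ℝ, 0 < δ ∧ ∀ x ∈ digitSum c M '' tameDigits c n, ∀ r, 0 < r → r ≤ δ →
      ENNReal.ofReal (8⁻¹ * r ^ t) ≤ digitSumLaw c M (Metric.closedBall x r) := by
  have hM : ∀ i, 2 ≤ M i := fun i => (hc.out i).trans (hcM i)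
  have hP : ∀ k, (0 : ℝ) < cumProd M k := fun k => by exact_mod_cast cumProd_pos hM k
  have hB : ∀ k, (0 : ℝ) < cumProd c k := fun k => by exact_mod_cast cumProd_pos hc.out k
  obtain ⟨k₀, hk₀⟩ := eventually_atTop.1
    (h.and (eventually_le_digitMeasure_cylinder_tame c hsum))
  set k₁ := max k₀ n with hk₁
  -- The 2 makes `y > 2` below, so `⌊y⌋₊ - 1` is a true subtraction.
  refine ⟨2 / cumProd M k₁, div_pos two_pos (hP _), ?_⟩
  intro x hx r hr hrδ
  obtain ⟨k, hk, hrk, hrk'⟩ := exists_scale (tendsto_cumProd_atTop hM) hr hrδ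
  rw [le_div_iff₀ (hP _)] at hrk
  rw [div_lt_iff₀ (hP _)] at hrk'
  obtain ⟨ω, hω, hωx⟩ := hx
  have hx' : x ∈ digitSum c M '' tameDigits c k :=
    ⟨ω, ⟨hω.1, fun i hi => hω.2 i (by omega)⟩, hωx⟩
  set y := r * cumProd M (k + 1) with hy
  set m := ⌊y⌋₊ - 1 with hm
  have hfloor2 : 2 ≤ ⌊y⌋₊ := Nat.le_floor (by exact_mod_cast hrk'.le)
  have hm1 : (m : ℝ) + 1 = ⌊y⌋₊ := by exact_mod_cast (by omega : m + 1 = ⌊y⌋₊)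
  have hmr : ((m : ℝ) + 1) / cumProd M (k + 1) ≤ r := by
    rw [div_le_iff₀ (hP _), hm1]
    exact Nat.floor_le (by linarith)
  refine le_trans ?_ (le_digitSumLaw_closedBall hcM hsum (hk₀ (k + 1) (by omega)).2 hmr hx')
  have hrew : ((min m (c k - 2) + 1 : ℕ) : ℝ≥0∞) * ((cumProd c (k + 1) : ℝ≥0∞)⁻¹ / 2) =
      ENNReal.ofReal (((min m (c k - 2) + 1 : ℕ) : ℝ) * ((cumProd c (k + 1) : ℝ)⁻¹ / 2)) := by
    rw [ENNReal.ofReal_mul (by positivity), ENNReal.ofReal_natCast,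
      ENNReal.ofReal_div_of_pos two_pos, ENNReal.ofReal_inv_of_pos (hB _), ENNReal.ofReal_natCast,
      ENNReal.ofReal_ofNat]
  rw [hrew]
  refine ENNReal.ofReal_le_ofReal ?_
  rcases le_total m (c k - 2) with hmc | hmc
  · rw [min_eq_left hmc]
    push_cast
    have h1 : y / 2 ≤ (m : ℝ) + 1 := by
      rw [hm1]
      have h2 := Nat.lt_floor_add_one y
      have h3 : (2 : ℝ) ≤ ⌊y⌋₊ := by exact_mod_cast hfloor2
      linarith
    have h2 : y ^ t ≤ y := Real.rpow_le_self_of_one_le (by linarith) ht1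
    have h3 : r ^ t * cumProd c (k + 1) ≤ y ^ t := by
      rw [hy, Real.mul_rpow hr.le (hP _).le]
      have := (hk₀ (k + 1) (by omega)).1
      gcongr
    have h4 : r ^ t ≤ y * (cumProd c (k + 1) : ℝ)⁻¹ := by
      rw [← div_eq_mul_inv, le_div_iff₀ (hB _)]
      linarith
    have h5 : y / 2 * ((cumProd c (k + 1) : ℝ)⁻¹ / 2) ≤
        ((m : ℝ) + 1) * ((cumProd c (k + 1) : ℝ)⁻¹ / 2) := by gcongr
    have h6 : 0 ≤ r ^ t := by positivity
    linarith
  -- Here the window is all unshifted digits: the mass is at least `1 / (4 * cumProd c k)`, and `r *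
  -- cumProd M k ≤ 2` yields the constant `8⁻¹`.
  · rw [min_eq_right hmc]
    have hck := hc.out k
    have hck' : (0 : ℝ) < c k := by exact_mod_cast two_pos.trans_le hck
    have h1 : (c k : ℝ) / 2 ≤ ((c k - 2 + 1 : ℕ) : ℝ) := by
      rw [div_le_iff₀ two_pos]
      exact_mod_cast (by omega : c k ≤ (c k - 2 + 1) * 2)
    have h2 : (c k : ℝ) / 2 * ((cumProd c (k + 1) : ℝ)⁻¹ / 2) = (cumProd c k : ℝ)⁻¹ / 4 := by
      have := hB k
      rw [cumProd_succ]
      push_cast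
      field_simp
      norm_num
    have h3 : r ^ t * cumProd c k ≤ 2 := by
      calc r ^ t * cumProd c k ≤ r ^ t * (cumProd M k : ℝ) ^ t := by
            have := (hk₀ k (by omega)).1
            gcongr
        _ = (r * cumProd M k) ^ t := (Real.mul_rpow hr.le (hP _).le).symm
        _ ≤ 2 ^ t := by
            have := mul_pos hr (hP k)
            gcongr
        _ ≤ 2 := Real.rpow_le_self_of_one_le one_le_two ht1
    have h4 : r ^ t ≤ 2 * (cumProd c k : ℝ)⁻¹ := by
      rw [← div_eq_mul_inv, le_div_iff₀ (hB _)]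
      exact h3
    have h5 : (c k : ℝ) / 2 * ((cumProd c (k + 1) : ℝ)⁻¹ / 2) ≤
        ((c k - 2 + 1 : ℕ) : ℝ) * ((cumProd c (k + 1) : ℝ)⁻¹ / 2) := by gcongr
    linarith

/-! ### The two dimension formulas -/

theorem lt_log_div_log_iff {B Q s : ℝ} (hB : 0 < B) (hQ : 1 < Q) :
    s < Real.log B / Real.log Q ↔ Q ^ s < B := by
  rw [lt_div_iff₀ (Real.log_pos hQ), ← Real.log_rpow (by linarith),
    Real.log_lt_log_iff (by positivity) hB]

theorem log_div_log_lt_iff {B Q s : ℝ} (hB : 0 < B) (hQ : 1 < Q) :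
    Real.log B / Real.log Q < s ↔ B < Q ^ s := by
  rw [div_lt_iff₀ (Real.log_pos hQ), ← Real.log_rpow (by linarith),
    Real.log_lt_log_iff hB (by positivity)]

theorem coe_lt_ofReal_iff {s : ℝ≥0} {x : ℝ} : (s : ℝ≥0∞) < ENNReal.ofReal x ↔ (s : ℝ) < x := by
  rw [← ENNReal.ofReal_coe_nnreal, ENNReal.ofReal_lt_ofReal_iff']
  exact ⟨fun h => h.1, fun h => ⟨h, s.2.trans_lt h⟩⟩

theorem lt_of_ofReal_lt_coe {s : ℝ≥0} {x : ℝ} (h : ENNReal.ofReal x < s) : x < s := by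
  rw [← ENNReal.ofReal_coe_nnreal] at h
  exact (ENNReal.ofReal_lt_ofReal_iff'.1 h).1

theorem eventually_one_lt_cumProd {M : ℕ → ℕ} (hM : ∀ i, 2 ≤ M i) :
    ∀ᶠ k in atTop, (1 : ℝ) < cumProd M k :=
  (tendsto_cumProd_atTop hM).eventually_gt_atTop 1

theorem dimH_support_digitSumLaw {c M : ℕ → ℕ} [hc : Fact (∀ i, 2 ≤ c i)]
    (hcM : ∀ i, c i ≤ M i) (hsum : Summable fun i => 1 / (c i : ℝ)) :
    dimH (digitSumLaw c M).support = liminf (fun k => ENNReal.ofReal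
      (Real.log (cumProd c k) / Real.log (coverScale c M k))) atTop := by
  have hM : ∀ i, 2 ≤ M i := fun i => (hc.out i).trans (hcM i)
  have hB : ∀ k, (0 : ℝ) < cumProd c k := fun k => by exact_mod_cast cumProd_pos hc.out k
  have hQ := (tendsto_coverScale_atTop hc.out hcM).eventually_gt_atTop 1
  refine le_antisymm ?_ ?_
  · refine (dimH_mono (support_digitSumLaw_subset hcM hsum)).trans ?_
    rw [dimH_iUnion]
    refine iSup_le fun n => dimH_le fun s hs => ?_
    by_contra! hlt
    obtain ⟨t, ht, hts⟩ := ENNReal.lt_iff_exists_nnreal_btwn.1 hlt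
    have hfr : ∃ᶠ k in atTop, (cumProd c k : ℝ) ≤ coverScale c M k ^ (t : ℝ) := by
      refine ((frequently_lt_of_liminf_lt (by isBoundedDefault) ht).and_eventually hQ).mono
        fun k hk => ?_
      exact ((log_div_log_lt_iff (hB k) hk.2).1 (lt_of_ofReal_lt_coe hk.1)).le
    have h0 := hausdorffMeasure_image_tameDigits_eq_zero hc.out hcM (s := s)
      (by exact_mod_cast ENNReal.coe_lt_coe.1 hts) hfr n
    exact ENNReal.zero_ne_top (h0.symm.trans hs)
  · refine ENNReal.le_of_forall_nnreal_lt fun s hs => ?_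
    rcases eq_or_ne s 0 with rfl | hs0
    · simp
    have hev : ∀ᶠ k in atTop, coverScale c M k ^ (s : ℝ) < cumProd c k := by
      filter_upwards [eventually_lt_of_lt_liminf hs, hQ] with k hk hQk
      exact (lt_log_div_log_iff (hB k) hQk).1 (coe_lt_ofReal_iff.1 hk)
    -- Automatic, since `cumProd c k ≤ coverScale c M k`.
    have hs1 : (s : ℝ) ≤ 1 := by
      obtain ⟨k, hk, hQk⟩ := (hev.and hQ).exists
      by_contra! h1
      have h2 : (cumProd c k : ℝ) ≤ cumProd M k := by exact_mod_cast cumProd_le_cumProd hcM k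
      have h3 := h2.trans (cumProd_le_coverScale hc.out hcM k)
      exact absurd (hk.trans_le h3) (not_lt.2 (Real.self_le_rpow_of_one_le hQk.le h1.le))
    obtain ⟨k₀, hk₀⟩ := eventually_atTop.1 hev
    exact le_dimH_of_measure_closedBall_le (tameMeasure c M) (tameMeasure_support_ne_zero hcM hsum)
      four_pos (one_div_pos.2 (by exact_mod_cast cumProd_pos hM k₀)) (pos_iff_ne_zero.2 hs0)
      fun x r hr hrδ => tameMeasure_closedBall_le_rpow hcM hsum s.2 hs1
        (fun k hk => (hk₀ k hk).le) x hr hrδ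

theorem dimP_support_digitSumLaw {c M : ℕ → ℕ} [hc : Fact (∀ i, 2 ≤ c i)]
    (hcM : ∀ i, c i ≤ M i) (hsum : Summable fun i => 1 / (c i : ℝ)) :
    dimP (digitSumLaw c M).support = limsup (fun k => ENNReal.ofReal
      (Real.log (cumProd c k) / Real.log (cumProd M k))) atTop := by
  have hM : ∀ i, 2 ≤ M i := fun i => (hc.out i).trans (hcM i)
  have hB : ∀ k, (0 : ℝ) < cumProd c k := fun k => by exact_mod_cast cumProd_pos hc.out k
  have hP := eventually_one_lt_cumProd hM
  refine le_antisymm ?_ ?_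
  · refine iSup₂_le fun s hs => ?_
    by_contra! hlt
    obtain ⟨t, ht, hts⟩ := ENNReal.lt_iff_exists_nnreal_btwn.1 hlt
    -- The ball estimate needs an exponent at most 1, and exponent 1 always works because `c i ≤ M
    -- i`.
    have hev : ∀ᶠ k in atTop, (cumProd c k : ℝ) ≤ (cumProd M k : ℝ) ^ (min (t : ℝ) 1) := by
      filter_upwards [eventually_lt_of_limsup_lt ht, hP] with k hk hPk
      rcases min_choice (t : ℝ) 1 with h | h <;> rw [h]
      · exact ((log_div_log_lt_iff (hB k) hPk).1 (lt_of_ofReal_lt_coe hk)).le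
      · rw [Real.rpow_one]
        exact_mod_cast cumProd_le_cumProd hcM k
    have hts' : min (t : ℝ) 1 < s :=
      (min_le_left _ _).trans_lt (by exact_mod_cast ENNReal.coe_lt_coe.1 hts)
    have h0 : packingMeasure s (⋃ n, digitSum c M '' tameDigits c n) = 0 := by
      refine packingMeasure_iUnion_eq_zero fun n => ?_
      obtain ⟨δ, hδ, h⟩ := rpow_le_digitSumLaw_closedBall hcM hsum
        (le_min t.2 zero_le_one) (min_le_right _ _) hev n
      exact packingPreMeasure_eq_zero_of_le_measure_closedBall (digitSumLaw c M)
        (by norm_num) hδ hts' h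
    have h1 := packingMeasure_mono s (support_digitSumLaw_subset hcM hsum)
    rw [h0, hs] at h1
    exact absurd h1 (by simp)
  · refine ENNReal.le_of_forall_nnreal_lt fun s hs => ?_
    refine le_iSup₂_of_le s ?_ le_rfl
    obtain ⟨t, hst, ht⟩ := ENNReal.lt_iff_exists_nnreal_btwn.1 hs
    have hfr : ∃ᶠ k in atTop, (cumProd M k : ℝ) ^ (t : ℝ) < cumProd c k := by
      refine ((frequently_lt_of_lt_limsup (by isBoundedDefault) ht).and_eventually hP).mono
        fun k hk => ?_
      exact (lt_log_div_log_iff (hB k) hk.2).1 (coe_lt_ofReal_iff.1 hk.1)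
    refine packingMeasure_eq_top_of_measure_closedBall_le (tameMeasure c M)
      (tameMeasure_support_ne_zero hcM hsum) (C := 6) (t := t)
      (by exact_mod_cast ENNReal.coe_lt_coe.1 hst) (by norm_num) fun δ hδ => ?_
    have hlim : Tendsto (fun k => 1 / (cumProd M k : ℝ)) atTop (𝓝 0) :=
      tendsto_const_nhds.div_atTop (tendsto_cumProd_atTop hM)
    obtain ⟨k, hk, hkδ⟩ := (hfr.and_eventually (hlim.eventually (gt_mem_nhds hδ))).exists
    have hPk : (0 : ℝ) < cumProd M k := by exact_mod_cast cumProd_pos hM k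
    have hinv : 0 < 1 / (cumProd M k : ℝ) := one_div_pos.2 hPk
    -- Then `2r = 1 / cumProd M k`, and the radius `4r` gives the cylinder count `2 * 2 + 2 = 6`,
    -- hence `C = 6`.
    refine ⟨1 / cumProd M k / 2, by positivity, by linarith, fun x => ?_⟩
    refine (tameMeasure_closedBall_le hcM hsum k x (by positivity)).trans
      (ENNReal.ofReal_le_ofReal ?_)
    rw [mul_div_cancel₀ _ two_ne_zero, one_div, Real.inv_rpow hPk.le]
    calc (2 * (4 * ((cumProd M k : ℝ)⁻¹ / 2)) * cumProd M k + 2) / cumProd c k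
        = 6 * (cumProd c k : ℝ)⁻¹ := by field_simp; norm_num
      _ ≤ _ := by
        have := hk.le
        gcongr

/-! ### Identification of the infinite convolution -/

theorem uniformOn_image {α β : Type*} [MeasurableSpace α] [MeasurableSingletonClass α]
    [MeasurableSpace β] [MeasurableSingletonClass β] {f : α → β} (hf : Measurable f) {s : Set α}
    (hs : s.Finite) (hinj : Set.InjOn f s) :
    ProbabilityTheory.uniformOn (f '' s) = (ProbabilityTheory.uniformOn s).map f := by
  ext t ht
  rw [Measure.map_apply hf ht, ProbabilityTheory.uniformOn, ProbabilityTheory.uniformOn,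
    ProbabilityTheory.cond_apply (hs.image f).measurableSet,
    ProbabilityTheory.cond_apply hs.measurableSet, ← Set.image_inter_preimage,
    Measure.count_apply (hs.image f).measurableSet, Measure.count_apply hs.measurableSet,
    Measure.count_apply ((hs.inter_of_left _).image f).measurableSet,
    Measure.count_apply (hs.inter_of_left _).measurableSet, hinj.encard_image,
    (hinj.mono Set.inter_subset_left).encard_image]

/-- The shift only raises the largest digit, so order is preserved; injectivity makes the uniform
measure on `A_k` the image of the uniform digit. -/
theorem digitTerm_injOn {c M : ℕ → ℕ} (hM : ∀ i, 2 ≤ M i) (i : ℕ) :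
    Set.InjOn (digitTerm c M i) (Finset.range (c i)) := by
  have hP : (0 : ℝ) < cumProd M (i + 1) := by exact_mod_cast cumProd_pos hM (i + 1)
  refine StrictMonoOn.injOn fun d hd e he hde => ?_
  simp only [Finset.coe_range, Set.mem_Iio] at hd he
  rw [digitTerm_of_small M (by omega), digitTerm]
  refine lt_add_of_lt_of_nonneg ?_ (by positivity)
  gcongr

theorem cumProd_shift (f : ℕ → ℕ) (k : ℕ) :
    cumProd (fun i => f (i + 1)) k = ∏ i ∈ Finset.Icc 1 k, f i := by
  rw [cumProd, Finset.range_eq_Ico, Finset.prod_Ico_add' f 0 k 1, zero_add]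
  rfl

theorem scaledDigitSet_succ {b N : ℕ → ℕ} (hb : ∀ i, 2 ≤ b (i + 1)) (hN : ∀ i, 2 ≤ N (i + 1))
    (n : ℕ) :
    scaledDigitSet b N (n + 1) = (Finset.range (b (n + 1))).image
      (digitTerm (fun i => b (i + 1)) (fun i => N (i + 1)) n) := by
  have hP : (0 : ℝ) < cumProd (fun i => N (i + 1)) (n + 1) := by
    exact_mod_cast cumProd_pos hN (n + 1)
  have hbn := hb n
  obtain ⟨m, hm⟩ : ∃ m, b (n + 1) = m + 1 := ⟨b (n + 1) - 1, by omega⟩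
  rw [scaledDigitSet, digitSet, Finset.image_insert, hm, Finset.range_add_one,
    Finset.image_insert, ← Nat.cast_prod, ← cumProd_shift]
  congr 1
  · simp only [digitTerm, hm, if_true, Nat.add_sub_cancel]
    push_cast
    field_simp
  · refine Finset.image_congr fun d hd => ?_
    rw [Nat.add_sub_cancel, Finset.coe_range, Set.mem_Iio] at hd
    simp only [digitTerm, hm]
    rw [if_neg (by omega), add_zero, div_eq_inv_mul]

theorem uniformDiscrete_eq_map {b N : ℕ → ℕ} (hb : ∀ i, 2 ≤ b (i + 1))
    (hN : ∀ i, 2 ≤ N (i + 1)) (n : ℕ) :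
    (uniformDiscrete (scaledDigitSet b N (n + 1)) (scaledDigitSet_nonempty b N (n + 1)) :
      Measure ℝ) = (digitLaw (fun i => b (i + 1)) n).map
        (digitTerm (fun i => b (i + 1)) (fun i => N (i + 1)) n) := by
  change ProbabilityTheory.uniformOn _ = _
  rw [scaledDigitSet_succ hb hN, Finset.coe_image, digitLaw]
  exact uniformOn_image (measurable_of_countable _) (Finset.finite_toSet _)
    (digitTerm_injOn (c := fun i => b (i + 1)) hN n)

theorem map_prefixSum_succ (c M : ℕ → ℕ) [Fact (∀ i, 2 ≤ c i)] (n : ℕ) :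
    (digitMeasure c).map (prefixSum c M (n + 1)) =
      (digitMeasure c).map (prefixSum c M n) ∗ (digitLaw c n).map (digitTerm c M n) := by
  have hmeas : ∀ i, Measurable (digitTerm c M i) := fun i => measurable_of_countable _
  have hind := ProbabilityTheory.iIndepFun_infinitePi (P := digitLaw c) hmeas
  have hmeas' : ∀ i, Measurable fun ω : ℕ → ℕ => digitTerm c M i (ω i) := fun i =>
    (hmeas i).comp (measurable_pi_apply i)
  have h1 := hind.indepFun_sum_range_succ hmeas' n
  have h2 : prefixSum c M n = ∑ j ∈ Finset.range n, fun ω : ℕ → ℕ => digitTerm c M j (ω j) := by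
    ext ω; simp [prefixSum]
  have h3 : prefixSum c M (n + 1) =
      prefixSum c M n + fun ω : ℕ → ℕ => digitTerm c M n (ω n) := by
    ext ω; exact prefixSum_succ c M n ω
  rw [h3, digitMeasure, ProbabilityTheory.IndepFun.map_add_eq_map_conv_map
    (measurable_prefixSum c M n) (hmeas' n) (h2 ▸ h1)]
  congr 1
  rw [← Measure.infinitePi_map_eval (digitLaw c) n, Measure.map_map (hmeas n)
    (measurable_pi_apply n)]
  rfl

theorem finConvolution_eq_map {b N : ℕ → ℕ} [hb : Fact (∀ i, 2 ≤ b (i + 1))]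
    (hN : ∀ i, 2 ≤ N (i + 1)) (n : ℕ) :
    (finConvolution (scaledDigitSet b N) (scaledDigitSet_nonempty b N) n : Measure ℝ) =
      (digitMeasure fun i => b (i + 1)).map
        (prefixSum (fun i => b (i + 1)) (fun i => N (i + 1)) n) := by
  induction n with
  | zero =>
    have : prefixSum (fun i => b (i + 1)) (fun i => N (i + 1)) 0 = fun _ => 0 := by
      ext ω; simp [prefixSum]
    rw [this, Measure.map_const, measure_univ, one_smul]
    rfl
  | succ n ih =>
    rw [map_prefixSum_succ, ← ih, ← uniformDiscrete_eq_map hb.out hN]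
    rfl

theorem isProbabilityMeasure_digitSumLaw {c M : ℕ → ℕ} [Fact (∀ i, 2 ≤ c i)]
    (hcM : ∀ i, c i ≤ M i) (hsum : Summable fun i => 1 / (c i : ℝ)) :
    IsProbabilityMeasure (digitSumLaw c M) :=
  Measure.isProbabilityMeasure_map (aemeasurable_digitSum hcM hsum)

/-- Almost sure convergence of the partial sums gives weak convergence of their laws, by dominated
convergence for bounded continuous `f`. -/
theorem isInfiniteConvolution_digitSumLaw {b N : ℕ → ℕ} [hb : Fact (∀ i, 2 ≤ b (i + 1))]
    (hbN : ∀ i, b (i + 1) ≤ N (i + 1)) (hsum : Summable fun i => 1 / (b (i + 1) : ℝ)) :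
    IsInfiniteConvolution (scaledDigitSet b N) (scaledDigitSet_nonempty b N)
      ⟨digitSumLaw (fun i => b (i + 1)) (fun i => N (i + 1)),
        isProbabilityMeasure_digitSumLaw hbN hsum⟩ := by
  refine ProbabilityMeasure.tendsto_iff_forall_integral_tendsto.2 ?_
  intro f
  simp only [finConvolution_eq_map fun i => (hb.out i).trans (hbN i), ProbabilityMeasure.coe_mk,
    digitSumLaw]
  rw [integral_map (aemeasurable_digitSum hbN hsum) f.continuous.aestronglyMeasurable]
  simp only [integral_map (measurable_prefixSum _ _ _).aemeasurable
    f.continuous.aestronglyMeasurable]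
  refine tendsto_integral_of_dominated_convergence (fun _ => ‖f‖) (fun n => ?_)
    (integrable_const _) (fun n => Eventually.of_forall fun ω => f.norm_coe_le_norm _) ?_
  · exact (f.continuous.measurable.comp (measurable_prefixSum _ _ n)).aestronglyMeasurable
  · filter_upwards [ae_summable_digitTerm hbN hsum] with ω hω
    exact (f.continuous.tendsto _).comp (tendsto_prefixSum hω)

theorem mainTheorem6 (b N : ℕ → ℕ)
    (hb : ∀ k, 1 ≤ k → 2 ≤ b k)
    (hbN : ∀ k, 1 ≤ k → b k ≤ N k)
    (hdvd : ∀ k, 1 ≤ k → b k ∣ N k)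
    (hsum : Summable fun k : ℕ => 1 / (b k : ℝ)) :
    (∃ μ : ProbabilityMeasure ℝ,
      IsInfiniteConvolution (scaledDigitSet b N) (scaledDigitSet_nonempty b N) μ) ∧
    ∀ μ : ProbabilityMeasure ℝ,
      IsInfiniteConvolution (scaledDigitSet b N) (scaledDigitSet_nonempty b N) μ →
      dimH (μ : Measure ℝ).support =
          liminf (fun k : ℕ => ENNReal.ofReal
            (Real.log (∏ i ∈ Finset.Icc 1 k, (b i : ℝ)) /
              (Real.log (∏ i ∈ Finset.Icc 1 (k + 1), (N i : ℝ)) - Real.log (b (k + 1) : ℝ)))) atTop ∧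
        dimP (μ : Measure ℝ).support =
          limsup (fun k : ℕ => ENNReal.ofReal
            (Real.log (∏ i ∈ Finset.Icc 1 k, (b i : ℝ)) /
              Real.log (∏ i ∈ Finset.Icc 1 k, (N i : ℝ)))) atTop := by
  have hb' : Fact (∀ i, 2 ≤ b (i + 1)) := ⟨fun i => hb _ (by omega)⟩
  have hbN' : ∀ i, b (i + 1) ≤ N (i + 1) := fun i => hbN _ (by omega)
  have hN' : ∀ i, 2 ≤ N (i + 1) := fun i => (hb'.out i).trans (hbN' i)
  have hsum' : Summable fun i => 1 / (b (i + 1) : ℝ) := (summable_nat_add_iff 1).2 hsum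
  have hlim := isInfiniteConvolution_digitSumLaw hbN' hsum'
  refine ⟨⟨_, hlim⟩, fun μ hμ => ?_⟩
  -- Weak limits are unique, so the formulas need only be proved for `digitSumLaw`.
  obtain rfl := tendsto_nhds_unique hμ hlim
  rw [ProbabilityMeasure.coe_mk, dimH_support_digitSumLaw hbN' hsum',
    dimP_support_digitSumLaw hbN' hsum']
  simp only [← Nat.cast_prod, ← cumProd_shift, coverScale]
  refine ⟨congrArg (liminf · atTop) (funext fun k => ?_), trivial⟩
  rw [Real.log_div]
  · exact_mod_cast (cumProd_pos hN' (k + 1)).ne'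
  · exact_mod_cast (two_pos.trans_le (hb'.out k)).ne'
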